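/- Let $n\ge 0$ and let $D\subseteq[n]\times[n]$ be a diagram, with columns $D_1,\dots,D_n\subseteq[n]$, where $i\in D_j$ if and only if the box in row $i$ and column $j$ belongs to $D$. *Dual character.* For $R=\{r_1<\dots<r_k\}$ and $S=\{s_1<\dots<s_k\}$ in $[n]$ write $R\le S$ if $r_i\le s_i$ for all $i$; for diagrams write $C\le D$ if $C_j\le D_j$ for all $j$ (in particular $|C_j|=|D_j|$). Let $Y$ be the $n\times n$ upper-triangular matrix of variables $y_{ij}$, $i\le j$, and let $\mathcal M_D\subseteq\mathbb C[Y]$ be the span of the polynomials $\prod_{j=1}^n\det\bigl(Y^{C_j}_{D_j}\bigr)$, $C\le D$, where $Y^R_S$ is the submatrix of $Y$ with rows $R$ and columns $S$ (the flagged Weyl module of $D$). The group of invertible upper-triangular complex matrices $b$ acts on $\mathbb C[Y]$ by $f(Y)\mapsto f(b^{-1}Y)$. The dual character $\chi_D(x)\in\mathbb C[x_1,\dots,x_n]$ is the polynomial whose value at $x\in(\mathbb C^\times)^n$ is the trace of the action of $\mathrm{diag}(x_1^{-1},\dots,x_n^{-1})$ on $\mathcal M_D$. *Multiplicity-free diagrams.*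 Consider the following six two-column configurations, with rows listed from top to bottom, where $\circ$ means that the box is present, $\times$ that it is absent, and $*$ that there is no restriction: $$\begin{array}{ll} (A)\ \times\times,\ \circ\times,\ *\circ & (B)\ \times\circ,\ \times\times,\ \circ\circ,\ \circ*\\ (C)\ \times\times,\ \times\times,\ \circ\circ,\ \circ* & (D)\ \times\circ,\ \circ\times,\ \circ\circ\\ (E)\ \times\circ,\ \circ\times,\ \circ\times,\ \times\circ & (F)\ \circ\times,\ \times\circ,\ \circ\times,\ \times\circ \end{array}$$ The diagram $D$ is multiplicity-free if there are no column indices $j_1<j_2$ and row indices $i_1<i_2<i_3$ (for (A) and (D)) or $i_1<i_2<i_3<i_4$ (for the others) such that the restriction of $D$ to these rows and columns is one of the six configurations or is obtained from one of them by swapping its two columns. **Corollary.** Every coefficient of $\chi_D(x)$ is $0$ or $1$ if and only if $D$ is multiplicity-free. -/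

import Mathlib

namespace FlaggedWeyl

noncomputable section

open Finset

/-- A diagram in the grid `[n] × [n]`, given by its columns: `D j` is the set of the rows `i` such
that the box in row `i` and column `j` belongs to the diagram. Rows and columns are indexed by
`Fin n`, and rows are numbered from top to bottom. -/
abbrev Diagram (n : ℕ) : Type := Fin n → Finset (Fin n)

/-- The Gale order on subsets of `[n]` of the same size: if `R = {r₁ < ⋯ < rₖ}` and
`S = {s₁ < ⋯ < sₖ}`, then `R ≤ S` means that `rᵢ ≤ sᵢ` for all `i`. -/
def GaleLE {n : ℕ} (R S : Finset (Fin n)) : Prop :=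
  ∃ h : R.card = S.card, ∀ k : Fin S.card, R.orderEmbOfFin h k ≤ S.orderEmbOfFin rfl k

/-- `C ≤ D` for diagrams: column by column in the Gale order. -/
def DiagramLE {n : ℕ} (C D : Diagram n) : Prop := ∀ j, GaleLE (C j) (D j)

/-- The index set of the variables `y i j`, `i ≤ j`. -/
abbrev YIndex (n : ℕ) : Type := {p : Fin n × Fin n // p.1 ≤ p.2}

/-- The polynomial ring `ℂ[Y]` in the variables `y i j`, `i ≤ j`. -/
abbrev YPoly (n : ℕ) : Type := MvPolynomial (YIndex n) ℂ

/-- The upper triangular matrix `Y` of variables. -/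
def matY (n : ℕ) : Matrix (Fin n) (Fin n) (YPoly n) :=
  Matrix.of fun i j => if h : i ≤ j then MvPolynomial.X ⟨(i, j), h⟩ else 0

/-- The minor `det (Y^R_S)` with row set `R` and column set `S`, both listed increasingly
(`0` if the two sets have different sizes, a case that does not occur below). -/
def minorY {n : ℕ} (R S : Finset (Fin n)) : YPoly n :=
  if h : R.card = S.card then
    ((matY n).submatrix (R.orderEmbOfFin h) (S.orderEmbOfFin rfl)).det
  else 0

/-- `det (Y^C_D)`, the product over all columns `j` of the minors `det (Y^{C_j}_{D_j})`. -/
def detY {n : ℕ} (C D : Diagram n) : YPoly n := ∏ j, minorY (C j) (D j)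

/-- The flagged Weyl module of `D`: the span of the polynomials `det (Y^C_D)`, `C ≤ D`. -/
def weylModule {n : ℕ} (D : Diagram n) : Submodule ℂ (YPoly n) :=
  Submodule.span ℂ {f | ∃ C : Diagram n, DiagramLE C D ∧ f = detY C D}

/-- The Borel group `B` of invertible upper triangular complex matrices. -/
def borel (n : ℕ) : Subgroup (GL (Fin n) ℂ) where
  carrier := {b | ∀ i j, j < i → (b : Matrix (Fin n) (Fin n) ℂ) i j = 0}
  one_mem' := by
    intro i j hij
    simp [hij.ne']
  mul_mem' := by
    intro a b ha hb i j hij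
    exact Matrix.BlockTriangular.mul (M := (a : Matrix (Fin n) (Fin n) ℂ))
      (N := (b : Matrix (Fin n) (Fin n) ℂ)) (b := id)
      (fun i j h => ha i j h) (fun i j h => hb i j h) hij
  inv_mem' := by
    intro a ha i j hij
    have hb : Matrix.BlockTriangular (a : Matrix (Fin n) (Fin n) ℂ) id := fun i j h => ha i j h
    let _ : Invertible (a : Matrix (Fin n) (Fin n) ℂ) := a.isUnit.invertible
    have := Matrix.blockTriangular_inv_of_blockTriangular hb
    rw [Matrix.coe_units_inv]
    exact this hij

/-- The action of `b ∈ B` on `ℂ[Y]`, `f(Y) ↦ f(b⁻¹ Y)`: the algebra endomorphism that sends each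
variable `y i j` to the `(i, j)` entry of `b⁻¹ Y`. -/
def act {n : ℕ} (b : borel n) : YPoly n →ₐ[ℂ] YPoly n :=
  MvPolynomial.aeval fun p : YIndex n =>
    ((((b⁻¹ : borel n) : GL (Fin n) ℂ) : Matrix (Fin n) (Fin n) ℂ).map
      (MvPolynomial.C : ℂ →+* YPoly n) * matY n : Matrix (Fin n) (Fin n) (YPoly n)) p.1.1 p.1.2

/-- The diagonal matrix with (nonzero) diagonal entries `x i`, as an element of `B`. -/
def diagB {n : ℕ} (x : Fin n → ℂˣ) : borel n :=
  ⟨{ val := Matrix.diagonal fun i => (x i : ℂ)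
     inv := Matrix.diagonal fun i => ((x i)⁻¹ : ℂˣ)
     val_inv := by simp [Matrix.diagonal_mul_diagonal]
     inv_val := by simp [Matrix.diagonal_mul_diagonal] },
   fun _ _ hij => Matrix.diagonal_apply_ne _ hij.ne'⟩

/-- The product of the numbers `x i` over all boxes of `C`, where `i` is the row of the box. -/
def boxWeight {n : ℕ} {R : Type*} [CommMonoid R] (x : Fin n → R) (C : Diagram n) : R :=
  ∏ j, ∏ i ∈ C j, x i

lemma diagB_inv {n : ℕ} (x : Fin n → ℂˣ) : (diagB x)⁻¹ = diagB x⁻¹ := by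
  apply Subtype.ext
  apply Units.ext
  change Matrix.diagonal _ = Matrix.diagonal _
  simp

lemma act_matY {n : ℕ} (x : Fin n → ℂˣ) (i j : Fin n) :
    act (diagB x⁻¹) (matY n i j) = MvPolynomial.C (x i : ℂ) * matY n i j := by
  by_cases h : i ≤ j
  · have h1 : matY n i j = MvPolynomial.X ⟨(i, j), h⟩ := by simp [matY, h]
    rw [h1, act, MvPolynomial.aeval_X, diagB_inv, inv_inv]
    have h2 : ((((diagB x : borel n) : GL (Fin n) ℂ) : Matrix (Fin n) (Fin n) ℂ)).map
        (MvPolynomial.C : ℂ →+* YPoly n) =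
        Matrix.diagonal fun i => MvPolynomial.C (x i : ℂ) := by
      change (Matrix.diagonal _).map _ = _
      rw [Matrix.diagonal_map (by simp)]
    rw [h2, Matrix.diagonal_mul, h1]
  · simp [matY, h]

lemma act_minorY {n : ℕ} (x : Fin n → ℂˣ) (R S : Finset (Fin n)) :
    act (diagB x⁻¹) (minorY R S) = MvPolynomial.C (∏ i ∈ R, (x i : ℂ)) * minorY R S := by
  unfold minorY
  split_ifs with h
  · rw [AlgHom.map_det]
    have h1 : (act (diagB x⁻¹)).mapMatrix
        ((matY n).submatrix (R.orderEmbOfFin h) (S.orderEmbOfFin rfl)) =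
        Matrix.of fun i j => MvPolynomial.C (x (R.orderEmbOfFin h i) : ℂ) *
          ((matY n).submatrix (R.orderEmbOfFin h) (S.orderEmbOfFin rfl)) i j := by
      ext1 i j
      simp [act_matY]
    rw [h1, Matrix.det_mul_column]
    congr 1
    rw [← map_prod]
    congr 1
    rw [← Finset.prod_image (s := Finset.univ) (g := R.orderEmbOfFin h)
      (f := fun i => (x i : ℂ)) (fun a _ b _ hab => (R.orderEmbOfFin h).injective hab)]
    congr 1
    apply Finset.coe_injective
    simp
  · simp

lemma act_detY {n : ℕ} (x : Fin n → ℂˣ) (C D : Diagram n) :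
    act (diagB x⁻¹) (detY C D) = boxWeight (fun i => (x i : ℂ)) C • detY C D := by
  simp only [detY, map_prod, act_minorY, Finset.prod_mul_distrib, boxWeight,
    MvPolynomial.smul_eq_C_mul]

/-- The flagged Weyl module is stable under diagonal matrices. -/
lemma act_diagB_mem {n : ℕ} (D : Diagram n) (x : Fin n → ℂˣ) :
    ∀ f ∈ weylModule D, (act (diagB x)).toLinearMap f ∈ weylModule D := by
  intro f hf
  induction hf using Submodule.span_induction with
  | mem f hf =>
    obtain ⟨C, hC, rfl⟩ := hf
    have := act_detY x⁻¹ C D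
    rw [inv_inv] at this
    rw [AlgHom.toLinearMap_apply, this]
    exact Submodule.smul_mem _ _ (Submodule.subset_span ⟨C, hC, rfl⟩)
  | zero => simp
  | add f g _ _ hf hg => rw [map_add]; exact Submodule.add_mem _ hf hg
  | smul c f _ hf => rw [map_smul]; exact Submodule.smul_mem _ _ hf

/-- The character of the flagged Weyl module: the trace of the action of the diagonal matrix with
diagonal entries `x i`. -/
def character {n : ℕ} (D : Diagram n) (x : Fin n → ℂˣ) : ℂ :=
  LinearMap.trace ℂ (weylModule D)
    ((act (diagB x)).toLinearMap.restrict (act_diagB_mem D x))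

/-- There is exactly one polynomial whose value at each point `x` with nonzero coordinates is the
character of the flagged Weyl module at `x⁻¹`. -/
theorem existsUnique_dualCharacter {n : ℕ} (D : Diagram n) :
    ∃! p : MvPolynomial (Fin n) ℂ,
      ∀ x : Fin n → ℂˣ, MvPolynomial.eval (fun i => (x i : ℂ)) p = character D x⁻¹ := by
  refine existsUnique_of_exists_of_unique ?_ ?_
  · let v : {C : Diagram n // DiagramLE C D} → weylModule D := fun C =>
      ⟨detY C.1 D, Submodule.subset_span ⟨C.1, C.2, rfl⟩⟩
    obtain ⟨κ, a, ha, hspan, hli⟩ := exists_linearIndependent' ℂ v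
    have hv : Submodule.span ℂ (Set.range v) = ⊤ := by
      apply Submodule.map_injective_of_injective (weylModule D).injective_subtype
      rw [Submodule.map_span, Submodule.map_subtype_top]
      unfold weylModule
      congr 1
      ext f
      constructor
      · rintro ⟨_, ⟨C, rfl⟩, rfl⟩
        exact ⟨C.1, C.2, rfl⟩
      · rintro ⟨C, hC, rfl⟩
        exact ⟨_, ⟨⟨C, hC⟩, rfl⟩, rfl⟩
    have : Finite κ := Finite.of_injective a ha
    have : Fintype κ := Fintype.ofFinite κ
    classical
    let B : Module.Basis κ ℂ (weylModule D) := Module.Basis.mk hli (by rw [hspan, hv])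
    refine ⟨∑ k : κ, boxWeight MvPolynomial.X (a k).1, fun x => ?_⟩
    have hB : ∀ k, ((act (diagB x⁻¹)).toLinearMap.restrict (act_diagB_mem D x⁻¹)) (B k) =
        boxWeight (fun i => (x i : ℂ)) (a k).1 • B k := by
      intro k
      apply Subtype.ext
      have hBk : B k = v (a k) := by simp [B]
      rw [hBk]
      exact act_detY x (a k).1 D
    rw [character, LinearMap.trace_eq_matrix_trace ℂ B, Matrix.trace, map_sum]
    refine Finset.sum_congr rfl fun k _ => ?_
    rw [Matrix.diag_apply, LinearMap.toMatrix_apply, hB]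
    simp [boxWeight]
  · intro p q hp hq
    refine MvPolynomial.funext_set (s := fun _ : Fin n => {z : ℂ | z ≠ 0}) ?_ ?_
    · intro i
      exact (Set.finite_singleton (0 : ℂ)).infinite_compl
    · intro x hx
      have h := (hp fun i => Units.mk0 (x i) (hx i trivial)).trans
        (hq fun i => Units.mk0 (x i) (hx i trivial)).symm
      simpa using h

/-- The dual character `χ_D(x) = char(M_D)(x₁⁻¹, …, xₙ⁻¹)`, as a polynomial in `x₁, …, xₙ`. -/
def dualCharacter {n : ℕ} (D : Diagram n) : MvPolynomial (Fin n) ℂ :=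
  (existsUnique_dualCharacter D).choose

/-- The defining property of the dual character. -/
theorem eval_dualCharacter {n : ℕ} (D : Diagram n) (x : Fin n → ℂˣ) :
    MvPolynomial.eval (fun i => (x i : ℂ)) (dualCharacter D) = character D x⁻¹ :=
  (existsUnique_dualCharacter D).choose_spec.1 x

/-- A polynomial is zero-one if each of its coefficients is `0` or `1`. -/
def IsZeroOne {σ : Type*} (p : MvPolynomial σ ℂ) : Prop :=
  ∀ a : σ →₀ ℕ, p.coeff a = 0 ∨ p.coeff a = 1

/-- An ordered pair of columns `P`, `Q` (the left and the right one) contains a multiplicitous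
configuration. The six lists show the rows of the configurations (A) to (F) from top to bottom,
with `o` for a box, `×` for no box and `*` for no restriction. A last row without restrictions is
not required to exist, so (A) and (D) involve three rows only. -/
inductive ContainsConfig {n : ℕ} (P Q : Finset (Fin n)) : Prop
  /-- rows: `× ×`, `o ×`, `* o` -/
  | A (i₁ i₂ i₃ : Fin n) (h₁₂ : i₁ < i₂) (h₂₃ : i₂ < i₃)
      (r₁ : i₁ ∉ P ∧ i₁ ∉ Q) (r₂ : i₂ ∈ P ∧ i₂ ∉ Q) (r₃ : i₃ ∈ Q)
  /-- rows: `× o`, `× ×`, `o o`, `o *` -/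
  | B (i₁ i₂ i₃ i₄ : Fin n) (h₁₂ : i₁ < i₂) (h₂₃ : i₂ < i₃) (h₃₄ : i₃ < i₄)
      (r₁ : i₁ ∉ P ∧ i₁ ∈ Q) (r₂ : i₂ ∉ P ∧ i₂ ∉ Q) (r₃ : i₃ ∈ P ∧ i₃ ∈ Q) (r₄ : i₄ ∈ P)
  /-- rows: `× ×`, `× ×`, `o o`, `o *` -/
  | C (i₁ i₂ i₃ i₄ : Fin n) (h₁₂ : i₁ < i₂) (h₂₃ : i₂ < i₃) (h₃₄ : i₃ < i₄)
      (r₁ : i₁ ∉ P ∧ i₁ ∉ Q) (r₂ : i₂ ∉ P ∧ i₂ ∉ Q) (r₃ : i₃ ∈ P ∧ i₃ ∈ Q) (r₄ : i₄ ∈ P)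
  /-- rows: `× o`, `o ×`, `o o` -/
  | D (i₁ i₂ i₃ : Fin n) (h₁₂ : i₁ < i₂) (h₂₃ : i₂ < i₃)
      (r₁ : i₁ ∉ P ∧ i₁ ∈ Q) (r₂ : i₂ ∈ P ∧ i₂ ∉ Q) (r₃ : i₃ ∈ P ∧ i₃ ∈ Q)
  /-- rows: `× o`, `o ×`, `o ×`, `× o` -/
  | E (i₁ i₂ i₃ i₄ : Fin n) (h₁₂ : i₁ < i₂) (h₂₃ : i₂ < i₃) (h₃₄ : i₃ < i₄)
      (r₁ : i₁ ∉ P ∧ i₁ ∈ Q) (r₂ : i₂ ∈ P ∧ i₂ ∉ Q) (r₃ : i₃ ∈ P ∧ i₃ ∉ Q)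
      (r₄ : i₄ ∉ P ∧ i₄ ∈ Q)
  /-- rows: `o ×`, `× o`, `o ×`, `× o` -/
  | F (i₁ i₂ i₃ i₄ : Fin n) (h₁₂ : i₁ < i₂) (h₂₃ : i₂ < i₃) (h₃₄ : i₃ < i₄)
      (r₁ : i₁ ∈ P ∧ i₁ ∉ Q) (r₂ : i₂ ∉ P ∧ i₂ ∈ Q) (r₃ : i₃ ∈ P ∧ i₃ ∉ Q)
      (r₄ : i₄ ∉ P ∧ i₄ ∈ Q)

/-- A diagram is multiplicitous if two of its columns contain a multiplicitous configuration, up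
to swapping the two columns of the configuration. -/
def IsMultiplicitous {n : ℕ} (D : Diagram n) : Prop :=
  ∃ j₁ j₂ : Fin n, j₁ < j₂ ∧ (ContainsConfig (D j₁) (D j₂) ∨ ContainsConfig (D j₂) (D j₁))

/-- A diagram is multiplicity-free if it is not multiplicitous. -/
def IsMultiplicityFree {n : ℕ} (D : Diagram n) : Prop := ¬ IsMultiplicitous D

end

end FlaggedWeyl

/-!
For a fixed weight, the weight space of the flagged Weyl module is spanned by the products
`detY C D` over the diagrams `C ≤ D` of that weight, so a coefficient of the dual character is the
dimension of such a span (`coeff_dualCharacter`).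

If two columns contain a multiplicitous configuration, moving boxes within the rows of the
configuration gives two diagrams `C, C' ≤ D` of the same weight. Their products of minors are told
apart by two unipotent matrices with few entries, so they are linearly independent and some
coefficient is at least `2` (`not_isZeroOne_of_containsConfig`).

Conversely, for a multiplicity-free diagram, `detY C D` depends on the weight of `C` only
(`prod_minorY_eq_of_rowCount_eq`). The basic tool is that a minor of an upper triangular matrix
factors along a horizontal line that has equally many rows and columns above it (`minorY_split`).
Columns without gaps above their last box are constant. For the others, let `b` be the lowest among
the first gaps of the columns. Avoiding the configurations forces the columns with a higher first
gap to have at most one box from row `b` on, in a row `s` common to all of them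
(`lower_part_of_first_gap_lt`, `not_mem_of_first_gaps`), while the columns with first gap `b` are
full above `b`. Hence the weight determines how many boxes cross the line at `b`, and the product
of minors separates into a part above the line, for fewer columns, and a part below it
(`prod_minorY_eq_of_cut`). Below the line, the columns form a chain of initial parts of one set
(`prod_minorY_eq_of_chain`), and there is a height `h` such that above `h` each column, once filled
up, has its only gap at `b`. So each `C` has at most one hole per column above `h`, each hole
contributes a factor that depends on its row only, and the multiset of holes is read off from the
weight (`prod_minorY_eq_of_lo_eq_seg`).
-/

namespace FlaggedWeyl

noncomputable section

open Finset

/-! ### Minors, cuts and the Gale order -/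

/-- The elements of `S` above the horizontal line at height `k`. -/
def lo {n : ℕ} (k : ℕ) (S : Finset (Fin n)) : Finset (Fin n) := S.filter fun i => (i : ℕ) < k

/-- The elements of `S` below the horizontal line at height `k`. -/
def hi {n : ℕ} (k : ℕ) (S : Finset (Fin n)) : Finset (Fin n) := S.filter fun i => k ≤ (i : ℕ)

section Minors

variable {n : ℕ}

@[simp] lemma mem_lo {k : ℕ} {S : Finset (Fin n)} {i : Fin n} :
    i ∈ lo k S ↔ i ∈ S ∧ (i : ℕ) < k := by simp [lo]

@[simp] lemma mem_hi {k : ℕ} {S : Finset (Fin n)} {i : Fin n} :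
    i ∈ hi k S ↔ i ∈ S ∧ k ≤ (i : ℕ) := by simp [hi]

lemma card_lo_add_card_hi (k : ℕ) (S : Finset (Fin n)) : #(lo k S) + #(hi k S) = #S := by
  have := card_filter_add_card_filter_not (s := S) (fun i : Fin n => (i : ℕ) < k)
  simpa [lo, hi, not_lt] using this

lemma lo_union_hi (k : ℕ) (S : Finset (Fin n)) : lo k S ∪ hi k S = S := by
  ext i
  simp only [mem_union, mem_lo, mem_hi]
  have := lt_or_ge (i : ℕ) k
  tauto

lemma card_lo_eq {S : Finset (Fin n)} {m : ℕ} (h : #S = m) (k : ℕ) :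
    #(lo k S) = #{l : Fin m | (S.orderEmbOfFin h l : ℕ) < k} := by
  rw [← card_map (S.orderEmbOfFin h).toEmbedding]
  congr 1
  ext i
  simp only [mem_lo, mem_map, mem_filter, mem_univ, true_and]
  constructor
  · rintro ⟨hi, hk⟩
    have : i ∈ Set.range (S.orderEmbOfFin h) := by simpa using hi
    obtain ⟨l, rfl⟩ := this
    exact ⟨l, hk, rfl⟩
  · rintro ⟨l, hl, rfl⟩
    exact ⟨S.orderEmbOfFin_mem h l, hl⟩

/-- The Gale order in terms of the number of elements above each horizontal line. -/
lemma galeLE_iff {R S : Finset (Fin n)} :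
    GaleLE R S ↔ #R = #S ∧ ∀ k, #(lo k S) ≤ #(lo k R) := by
  constructor
  · rintro ⟨h, H⟩
    refine ⟨h, fun k => ?_⟩
    rw [card_lo_eq rfl, card_lo_eq h]
    refine card_le_card fun l hl => ?_
    simp only [mem_filter, mem_univ, true_and] at hl ⊢
    exact lt_of_le_of_lt (H l) hl
  · rintro ⟨h, H⟩
    refine ⟨h, fun l => ?_⟩
    by_contra! hlt
    have h1 := H ((S.orderEmbOfFin rfl l : ℕ) + 1)
    rw [card_lo_eq rfl, card_lo_eq h] at h1
    have h2 : #{m : Fin #S | (R.orderEmbOfFin h m : ℕ) < (S.orderEmbOfFin rfl l : ℕ) + 1}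
        ≤ #(Iio l) := by
      refine card_le_card fun m hm => ?_
      simp only [mem_filter, mem_univ, true_and, mem_Iio] at hm ⊢
      rw [← (R.orderEmbOfFin h).lt_iff_lt]
      exact lt_of_le_of_lt (Nat.lt_succ_iff.mp hm) hlt
    have h3 : #(Iic l) ≤
        #{m : Fin #S | (S.orderEmbOfFin rfl m : ℕ) < (S.orderEmbOfFin rfl l : ℕ) + 1} := by
      refine card_le_card fun m hm => ?_
      simp only [mem_filter, mem_univ, true_and, mem_Iic] at hm ⊢
      exact Nat.lt_succ_of_le ((S.orderEmbOfFin rfl).monotone hm)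
    rw [Fin.card_Iio] at h2
    rw [Fin.card_Iic] at h3
    omega

lemma GaleLE.card_eq {R S : Finset (Fin n)} (h : GaleLE R S) : #R = #S := (galeLE_iff.1 h).1

lemma GaleLE.card_lo_le {R S : Finset (Fin n)} (h : GaleLE R S) (k : ℕ) :
    #(lo k S) ≤ #(lo k R) := (galeLE_iff.1 h).2 k

lemma GaleLE.card_hi_le {R S : Finset (Fin n)} (h : GaleLE R S) (k : ℕ) :
    #(hi k R) ≤ #(hi k S) := by
  have h1 := card_lo_add_card_hi k R
  have h2 := card_lo_add_card_hi k S
  have h3 := h.card_lo_le k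
  have h4 := h.card_eq
  omega

lemma galeLE_refl (S : Finset (Fin n)) : GaleLE S S := ⟨rfl, fun _ => le_rfl⟩

/-- `S` and everything below it in the Gale order have the same full initial part. -/
lemma GaleLE.mem_of_forall_lt_mem {R S : Finset (Fin n)} (h : GaleLE R S) {k : ℕ}
    (hS : ∀ i : Fin n, (i : ℕ) < k → i ∈ S) (i : Fin n) (hi : (i : ℕ) < k) : i ∈ R := by
  have h1 : lo k S = lo k univ := by
    ext i
    simp only [mem_lo, mem_univ, true_and]
    exact ⟨fun h => h.2, fun h => ⟨hS i h, h⟩⟩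
  have h2 : lo k R ⊆ lo k univ := fun i hi => by
    simp only [mem_lo, mem_univ, true_and] at hi ⊢
    exact hi.2
  have h3 : lo k R = lo k univ := eq_of_subset_of_card_le h2 (by rw [← h1]; exact h.card_lo_le k)
  have : i ∈ lo k R := by rw [h3]; simpa using hi
  exact (mem_lo.1 this).1

lemma minorY_eq {R S : Finset (Fin n)} {m : ℕ} (hR : #R = m) (hS : #S = m) :
    minorY R S = ((matY n).submatrix (R.orderEmbOfFin hR) (S.orderEmbOfFin hS)).det := by
  subst hS
  rw [minorY, dif_pos hR]

lemma minorY_of_card_ne {R S : Finset (Fin n)} (h : #R ≠ #S) : minorY R S = 0 := by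
  rw [minorY, dif_neg h]

lemma matY_eq_zero {i j : Fin n} (h : j < i) : matY n i j = 0 := by
  simp [matY, not_le.2 h]

lemma orderEmbOfFin_add {S : Finset (Fin n)} {k a c : ℕ} (ha : #(lo k S) = a)
    (hc : #(hi k S) = c) (h : #S = a + c) :
    (∀ i, S.orderEmbOfFin h (Fin.castAdd c i) = (lo k S).orderEmbOfFin ha i) ∧
    (∀ i, S.orderEmbOfFin h (Fin.natAdd a i) = (hi k S).orderEmbOfFin hc i) := by
  have key : Fin.addCases (motive := fun _ => Fin n) ((lo k S).orderEmbOfFin ha)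
      ((hi k S).orderEmbOfFin hc) = S.orderEmbOfFin h := by
    apply orderEmbOfFin_unique h
    · intro x
      refine Fin.addCases (fun i => ?_) (fun i => ?_) x
      · rw [Fin.addCases_left]
        exact (mem_lo.1 (orderEmbOfFin_mem _ ha i)).1
      · rw [Fin.addCases_right]
        exact (mem_hi.1 (orderEmbOfFin_mem _ hc i)).1
    · intro x y
      refine Fin.addCases (fun i => ?_) (fun i => ?_) x <;>
        refine Fin.addCases (fun j => ?_) (fun j => ?_) y <;> intro hxy
      · rw [Fin.addCases_left, Fin.addCases_left, OrderEmbedding.lt_iff_lt]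
        exact hxy
      · rw [Fin.addCases_left, Fin.addCases_right]
        exact Fin.lt_def.2 <| lt_of_lt_of_le (mem_lo.1 (orderEmbOfFin_mem _ ha i)).2
          (mem_hi.1 (orderEmbOfFin_mem _ hc j)).2
      · have : a + (i : ℕ) < j := hxy
        have := j.2
        omega
      · have : a + (i : ℕ) < a + (j : ℕ) := hxy
        rw [Fin.addCases_right, Fin.addCases_right, OrderEmbedding.lt_iff_lt]
        exact Fin.lt_def.2 (by omega)
  constructor <;> intro i <;> rw [← key]
  · rw [Fin.addCases_left]
  · rw [Fin.addCases_right]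

/-- A minor of an upper triangular matrix splits into two along every horizontal line above which
it has as many rows as columns, since the lower left block vanishes. -/
lemma minorY_split (k : ℕ) {R S : Finset (Fin n)} (h : #(lo k R) = #(lo k S)) :
    minorY R S = minorY (lo k R) (lo k S) * minorY (hi k R) (hi k S) := by
  have h1 := card_lo_add_card_hi k R
  have h2 := card_lo_add_card_hi k S
  by_cases hc : #(hi k R) = #(hi k S)
  · rw [minorY_eq (m := #(lo k S) + #(hi k S)) (by omega) (by omega), minorY_eq h rfl,
      minorY_eq hc rfl]
    obtain ⟨r1, r2⟩ := orderEmbOfFin_add (S := R) h hc (by omega)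
    obtain ⟨s1, s2⟩ := orderEmbOfFin_add (S := S) (k := k) rfl rfl (by omega)
    rw [← Matrix.det_fromBlocks_zero₂₁ _ ((matY n).submatrix ((lo k R).orderEmbOfFin h)
      ((hi k S).orderEmbOfFin rfl)), ← Matrix.det_submatrix_equiv_self finSumFinEquiv]
    congr 1
    ext1 x y
    rcases x with x | x <;> rcases y with y | y <;>
      simp only [Matrix.submatrix_apply, finSumFinEquiv_apply_left, finSumFinEquiv_apply_right,
        r1, r2, s1, s2, Matrix.fromBlocks_apply₁₁, Matrix.fromBlocks_apply₁₂,
        Matrix.fromBlocks_apply₂₁, Matrix.fromBlocks_apply₂₂]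
    exact matY_eq_zero <| Fin.lt_def.2 <| lt_of_lt_of_le
      (mem_lo.1 (orderEmbOfFin_mem _ rfl y)).2 (mem_hi.1 (orderEmbOfFin_mem _ hc x)).2
  · rw [minorY_of_card_ne hc, minorY_of_card_ne (by omega), mul_zero]

lemma minorY_empty : minorY (∅ : Finset (Fin n)) ∅ = 1 := by
  rw [minorY_eq (m := 0) rfl rfl]
  exact Matrix.det_fin_zero

lemma minorY_singleton (r s : Fin n) : minorY {r} {s} = matY n r s := by
  rw [minorY_eq (m := 1) rfl rfl, Matrix.det_fin_one]
  simp

/-- Evaluation of polynomials in the entries of `Y` at a matrix `M`, whose entries below the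
diagonal play no role. -/
def evalAt (M : Matrix (Fin n) (Fin n) ℂ) : YPoly n →ₐ[ℂ] ℂ :=
  MvPolynomial.aeval fun p : YIndex n => M p.1.1 p.1.2

lemma evalAt_matY {M : Matrix (Fin n) (Fin n) ℂ} (hM : M.BlockTriangular id) (i j : Fin n) :
    evalAt M (matY n i j) = M i j := by
  by_cases h : i ≤ j
  · simp [matY, h, evalAt]
  · simp [matY, h, hM (not_le.1 h)]

lemma evalAt_minorY {M : Matrix (Fin n) (Fin n) ℂ} (hM : M.BlockTriangular id)
    {R S : Finset (Fin n)} (h : #R = #S) :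
    evalAt M (minorY R S) =
      (M.submatrix (R.orderEmbOfFin h) (S.orderEmbOfFin rfl)).det := by
  rw [minorY_eq h rfl, AlgHom.map_det]
  congr 1
  ext1 i j
  exact evalAt_matY hM _ _

/-- A minor that does not vanish at some triangular matrix is indexed by a Gale pair. -/
lemma galeLE_of_evalAt_ne_zero {M : Matrix (Fin n) (Fin n) ℂ} (hM : M.BlockTriangular id)
    {R S : Finset (Fin n)} (h : evalAt M (minorY R S) ≠ 0) : GaleLE R S := by
  by_cases hc : #R = #S
  · rw [evalAt_minorY hM hc, Matrix.det_apply] at h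
    obtain ⟨π, -, hπ⟩ := exists_ne_zero_of_sum_ne_zero h
    have hle : ∀ l, R.orderEmbOfFin hc (π l) ≤ S.orderEmbOfFin rfl l := by
      intro l
      by_contra! hlt
      exact hπ (by rw [prod_eq_zero (mem_univ l) (hM hlt), smul_zero])
    refine galeLE_iff.2 ⟨hc, fun k => ?_⟩
    rw [card_lo_eq rfl, card_lo_eq hc]
    refine card_le_card_of_injOn π (fun l hl => ?_) π.injective.injOn
    simp only [coe_filter, mem_univ, true_and, Set.mem_ofPred_eq] at hl ⊢
    exact lt_of_le_of_lt (hle l) hl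
  · rw [minorY_of_card_ne hc, map_zero] at h
    exact absurd rfl h

/-- An order-free test for the nonvanishing of a minor: the rows `R` of `M` are injective on the
vectors supported on `S`. -/
lemma evalAt_minorY_ne_zero {M : Matrix (Fin n) (Fin n) ℂ} (hM : M.BlockTriangular id)
    {R S : Finset (Fin n)} (hc : #R = #S)
    (h : ∀ v : Fin n → ℂ, (∀ i ∉ S, v i = 0) → (∀ i ∈ R, (M.mulVec v) i = 0) → ∀ i, v i = 0) :
    evalAt M (minorY R S) ≠ 0 := by
  rw [evalAt_minorY hM hc]
  intro h0
  obtain ⟨w, hw, hMw⟩ := Matrix.exists_mulVec_eq_zero_iff.2 h0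
  let e := S.orderEmbOfFin rfl
  let v : Fin n → ℂ := Function.extend e w 0
  have hv : ∀ l, v (e l) = w l := fun l => e.injective.extend_apply w 0 l
  have hv0 : ∀ i ∉ S, v i = 0 := fun i hi => by
    refine Function.extend_apply' _ _ i ?_
    rintro ⟨l, rfl⟩
    exact hi (S.orderEmbOfFin_mem rfl l)
  refine hw (funext fun l => ?_)
  rw [← hv]
  refine h v hv0 (fun i hi => ?_) _
  have : i ∈ Set.range (R.orderEmbOfFin hc) := by simpa using hi
  obtain ⟨l, rfl⟩ := this
  have h2 := congrFun hMw l
  simp only [Matrix.mulVec, dotProduct, Matrix.submatrix_apply, Pi.zero_apply] at h2 ⊢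
  rw [← h2, ← sum_subset (subset_univ S)
    (fun i _ hi => by rw [hv0 i hi, mul_zero])]
  have hsum : ∀ f : Fin n → ℂ, ∑ i ∈ S, f i = ∑ l, f (e l) := fun f => by
    have := sum_map univ e.toEmbedding f
    rwa [map_orderEmbOfFin_univ] at this
  rw [hsum]
  exact sum_congr rfl fun l _ => by rw [hv]

lemma evalAt_minorY_eq_zero {M : Matrix (Fin n) (Fin n) ℂ} (hM : M.BlockTriangular id)
    {R S : Finset (Fin n)} {s : Fin n} (hs : s ∈ S) (h : ∀ i ∈ R, M i s = 0) :
    evalAt M (minorY R S) = 0 := by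
  by_cases hc : #R = #S
  · rw [evalAt_minorY hM hc]
    have : s ∈ Set.range (S.orderEmbOfFin rfl) := by simpa using hs
    obtain ⟨l, rfl⟩ := this
    exact Matrix.det_eq_zero_of_column_eq_zero l fun i => h _ (orderEmbOfFin_mem _ _ _)
  · rw [minorY_of_card_ne hc, map_zero]

lemma evalAt_one_minorY_self_ne_zero (S : Finset (Fin n)) : evalAt 1 (minorY S S) ≠ 0 := by
  refine evalAt_minorY_ne_zero (Matrix.blockTriangular_one) rfl fun v h0 h1 i => ?_
  by_cases hi : i ∈ S
  · simpa using h1 i hi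
  · exact h0 i hi

lemma minorY_self_ne_zero (S : Finset (Fin n)) : minorY S S ≠ 0 := fun h =>
  evalAt_one_minorY_self_ne_zero S (by rw [h, map_zero])

end Minors

/-! ### Coefficients of the dual character -/

section Coefficients

variable {n : ℕ}

/-- The number of boxes in row `i`, counted over the columns in `J`. -/
def rowCount {ι : Type*} (J : Finset ι) (A : ι → Finset (Fin n)) (i : Fin n) : ℕ :=
  #{j ∈ J | i ∈ A j}

lemma prod_prod_eq_prod_pow_rowCount {ι R : Type*} [CommMonoid R] (J : Finset ι)
    (A : ι → Finset (Fin n)) (f : Fin n → R) :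
    ∏ j ∈ J, ∏ i ∈ A j, f i = ∏ i, f i ^ rowCount J A i := by
  have h1 : ∀ j ∈ J, ∏ i ∈ A j, f i = ∏ i, if i ∈ A j then f i else 1 := fun j _ => by
    rw [prod_ite_mem, univ_inter]
  rw [prod_congr rfl h1, prod_comm]
  refine prod_congr rfl fun i _ => ?_
  rw [rowCount, ← prod_filter, prod_const]

/-- The exponent vector of the weight of a diagram. -/
def weight (C : Diagram n) : Fin n →₀ ℕ := Finsupp.equivFunOnFinite.symm (rowCount univ C)

lemma boxWeight_X (C : Diagram n) :
    boxWeight (MvPolynomial.X : Fin n → MvPolynomial (Fin n) ℂ) C =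
      MvPolynomial.monomial (weight C) 1 := by
  rw [boxWeight, prod_prod_eq_prod_pow_rowCount, MvPolynomial.monomial_eq, map_one, one_mul,
    Finsupp.prod_fintype _ _ (fun _ => pow_zero _)]
  rfl

lemma weylModule_eq_span (D : Diagram n) :
    weylModule D =
      Submodule.span ℂ (Set.range fun C : {C : Diagram n // DiagramLE C D} => detY C.1 D) := by
  unfold weylModule
  congr 1
  ext f
  constructor
  · rintro ⟨C, hC, rfl⟩
    exact ⟨⟨C, hC⟩, rfl⟩
  · rintro ⟨⟨C, hC⟩, rfl⟩
    exact ⟨C, hC, rfl⟩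

/-- Any basis of the flagged Weyl module extracted from its spanning set computes the dual
character. -/
lemma dualCharacter_eq_sum {D : Diagram n} {κ : Type*} [Fintype κ]
    (a : κ → {C : Diagram n // DiagramLE C D})
    (hli : LinearIndependent ℂ fun k => detY (a k).1 D)
    (hspan : Submodule.span ℂ (Set.range fun k => detY (a k).1 D) = weylModule D) :
    dualCharacter D = ∑ k, MvPolynomial.monomial (weight (a k).1) 1 := by
  classical
  refine (existsUnique_dualCharacter D).unique (eval_dualCharacter D) fun x => ?_
  let B : Module.Basis κ ℂ (weylModule D) :=
    (Module.Basis.span hli).map (LinearEquiv.ofEq _ _ hspan)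
  have hBk : ∀ k, (B k : YPoly n) = detY (a k).1 D := fun k => by
    simp [B, Module.Basis.span_apply]
  have hB : ∀ k, ((act (diagB x⁻¹)).toLinearMap.restrict (act_diagB_mem D x⁻¹)) (B k) =
      boxWeight (fun i => (x i : ℂ)) (a k).1 • B k := by
    intro k
    apply Subtype.ext
    rw [LinearMap.coe_restrict_apply, hBk, Submodule.coe_smul, hBk]
    exact act_detY x (a k).1 D
  rw [character, LinearMap.trace_eq_matrix_trace ℂ B, Matrix.trace, map_sum]
  refine sum_congr rfl fun k _ => ?_
  rw [Matrix.diag_apply, LinearMap.toMatrix_apply, hB, ← boxWeight_X]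
  simp [boxWeight]

lemma coeff_dualCharacter {D : Diagram n} {κ : Type*} [Fintype κ]
    (a : κ → {C : Diagram n // DiagramLE C D})
    (hli : LinearIndependent ℂ fun k => detY (a k).1 D)
    (hspan : Submodule.span ℂ (Set.range fun k => detY (a k).1 D) = weylModule D)
    (w : Fin n →₀ ℕ) :
    (dualCharacter D).coeff w = #{k | weight (a k).1 = w} := by
  classical
  rw [dualCharacter_eq_sum a hli hspan, MvPolynomial.coeff_sum]
  simp [MvPolynomial.coeff_monomial]

/-- If the generators of the flagged Weyl module depend on their weight only, then its weight
spaces are at most one-dimensional. -/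
lemma isZeroOne_of_detY_eq {D : Diagram n}
    (h : ∀ C C' : Diagram n, DiagramLE C D → DiagramLE C' D →
      rowCount univ C = rowCount univ C' → detY C D = detY C' D) :
    IsZeroOne (dualCharacter D) := by
  obtain ⟨κ, a, ha, hspan, hli⟩ := exists_linearIndependent' ℂ
    fun C : {C : Diagram n // DiagramLE C D} => detY C.1 D
  have : Finite κ := Finite.of_injective a ha
  have : Fintype κ := Fintype.ofFinite κ
  intro w
  rw [coeff_dualCharacter a hli (hspan.trans (weylModule_eq_span D).symm)]
  have : #{k | weight (a k).1 = w} ≤ 1 := by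
    refine card_le_one.2 fun k hk l hl => hli.injective ?_
    simp only [mem_filter, mem_univ, true_and] at hk hl
    exact h _ _ (a k).2 (a l).2 (Finsupp.equivFunOnFinite.symm.injective (hk.trans hl.symm))
  interval_cases #{k | weight (a k).1 = w} <;> simp

/-- Two linearly independent generators of the same weight make the weight space at least
two-dimensional; the linear independence is tested at two matrices. -/
lemma not_isZeroOne_of_evalAt {D C C' : Diagram n} (hC : DiagramLE C D) (hC' : DiagramLE C' D)
    (hw : rowCount univ C = rowCount univ C') {M N : Matrix (Fin n) (Fin n) ℂ}
    (h1 : evalAt M (detY C D) ≠ 0) (h2 : evalAt M (detY C' D) = 0)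
    (h3 : evalAt N (detY C' D) ≠ 0) : ¬ IsZeroOne (dualCharacter D) := by
  classical
  let v := fun C : {C : Diagram n // DiagramLE C D} => detY C.1 D
  have hne : (⟨C, hC⟩ : {C : Diagram n // DiagramLE C D}) ≠ ⟨C', hC'⟩ := by
    intro h
    rw [Subtype.mk.injEq] at h
    exact h1 (h ▸ h2)
  have hli : LinearIndepOn ℂ v {⟨C, hC⟩, ⟨C', hC'⟩} := by
    rw [LinearIndepOn.pair_iff _ hne]
    intro s t hst
    have hs : s = 0 := by
      have := congrArg (evalAt M) hst
      simpa [v, h1, h2] using this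
    refine ⟨hs, ?_⟩
    have := congrArg (evalAt N) hst
    simpa [v, hs, h3] using this
  obtain ⟨b, -, hsb, hspan, hb⟩ := exists_linearIndepOn_extension hli (Set.subset_univ _)
  have : Fintype b := Fintype.ofFinite b
  intro h01
  have hspan' : Submodule.span ℂ (Set.range fun k : b => detY k.1.1 D) = weylModule D := by
    have hr : (Set.range fun k : b => detY k.1.1 D) = v '' b := by
      rw [Set.image_eq_range]
    rw [hr, weylModule_eq_span]
    refine le_antisymm (Submodule.span_mono (Set.image_subset_range _ _)) ?_
    rw [Submodule.span_le, ← Set.image_univ]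
    exact hspan
  have hcoeff := coeff_dualCharacter (fun k : b => k.1) hb hspan' (weight C)
  have hcard : 1 < #{k : b | weight k.1.1 = weight C} := by
    refine one_lt_card.2 ⟨⟨⟨C, hC⟩, hsb (by simp)⟩, by simp, ⟨⟨C', hC'⟩, hsb (by simp)⟩, ?_, ?_⟩
    · simp [weight, hw]
    · intro h
      exact hne (congrArg Subtype.val h)
  rcases h01 (weight C) with h | h <;> rw [hcoeff] at h
  · norm_cast at h
    omega
  · norm_cast at h
    omega

end Coefficients

/-! ### Multiplicitous configurations -/

section Configurations

variable {n : ℕ}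

/-- The matrix `1 + ∑ E_e`, where `e` runs over the list `l` of positions and `E_e` is the matrix
unit at `e`. -/
def onePlusUnits (l : List (Fin n × Fin n)) : Matrix (Fin n) (Fin n) ℂ :=
  1 + (l.map fun e => Matrix.single e.1 e.2 (1 : ℂ)).sum

lemma onePlusUnits_apply (l : List (Fin n × Fin n)) (i s : Fin n) :
    onePlusUnits l i s =
      (if i = s then 1 else 0) + (l.map fun e => if e.1 = i ∧ e.2 = s then (1 : ℂ) else 0).sum := by
  have : (l.map fun e => Matrix.single e.1 e.2 (1 : ℂ)).sum i s =
      (l.map fun e => if e.1 = i ∧ e.2 = s then (1 : ℂ) else 0).sum := by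
    induction l with
    | nil => simp
    | cons e l ih => simp [ih, Matrix.single_apply]
  rw [onePlusUnits, Matrix.add_apply, this, Matrix.one_apply]

lemma onePlusUnits_mulVec (l : List (Fin n × Fin n)) (v : Fin n → ℂ) (i : Fin n) :
    (onePlusUnits l).mulVec v i = v i + (l.map fun e => if e.1 = i then v e.2 else 0).sum := by
  have : ((l.map fun e => Matrix.single e.1 e.2 (1 : ℂ)).sum.mulVec v) i =
      (l.map fun e => if e.1 = i then v e.2 else 0).sum := by
    induction l with
    | nil => simp
    | cons e l ih =>
      simp [ih, Matrix.add_mulVec, Matrix.single_mulVec, Function.update_apply, eq_comm]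
  rw [onePlusUnits, Matrix.add_mulVec, Pi.add_apply, this, Matrix.one_mulVec]

/-- The units above the diagonal give a unipotent upper triangular matrix. -/
lemma blockTriangular_onePlusUnits {l : List (Fin n × Fin n)} (hl : ∀ e ∈ l, e.1 < e.2) :
    (onePlusUnits l).BlockTriangular id := by
  intro i s hsi
  have hsi : s < i := hsi
  rw [onePlusUnits_apply, if_neg hsi.ne', zero_add]
  refine List.sum_eq_zero fun x hx => ?_
  obtain ⟨e, he, rfl⟩ := List.mem_map.1 hx
  refine if_neg fun h => ?_
  have := hl e he
  rw [h.1, h.2] at this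
  exact lt_asymm this hsi

lemma evalAt_onePlusUnits_minorY_self_ne_zero {l : List (Fin n × Fin n)}
    (hl : ∀ e ∈ l, e.1 < e.2) (S : Finset (Fin n)) :
    evalAt (onePlusUnits l) (minorY S S) ≠ 0 := by
  have hM := blockTriangular_onePlusUnits hl
  rw [evalAt_minorY hM rfl, Matrix.det_of_isUpperTriangular]
  · refine prod_ne_zero_iff.2 fun k _ => ?_
    rw [Matrix.submatrix_apply, onePlusUnits_apply, if_pos rfl, List.sum_eq_zero]
    · simp
    · intro x hx
      obtain ⟨e, he, rfl⟩ := List.mem_map.1 hx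
      exact if_neg fun h => (hl e he).ne (h.1.trans h.2.symm)
  · intro i s hsi
    exact hM ((S.orderEmbOfFin rfl).lt_iff_lt.2 hsi)

/-- The minor of `onePlusUnits l` with rows `R` and columns `S` does not vanish: the sizes agree,
and the rows in `R` are injective on the vectors supported on `S`. -/
def IsNonsingularMinor (l : List (Fin n × Fin n)) (R S : Finset (Fin n)) : Prop :=
  #R = #S ∧ ∀ v : Fin n → ℂ, (∀ i ∉ S, v i = 0) →
    (∀ i ∈ R, v i + (l.map fun e => if e.1 = i then v e.2 else 0).sum = 0) → ∀ i, v i = 0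

lemma IsNonsingularMinor.evalAt_ne_zero {l : List (Fin n × Fin n)} (hl : ∀ e ∈ l, e.1 < e.2)
    {R S : Finset (Fin n)} (h : IsNonsingularMinor l R S) :
    evalAt (onePlusUnits l) (minorY R S) ≠ 0 := by
  refine evalAt_minorY_ne_zero (blockTriangular_onePlusUnits hl) h.1 fun v h0 h1 => h.2 v h0 ?_
  intro i hi
  rw [← onePlusUnits_mulVec]
  exact h1 i hi

/-- The diagram `D` with the columns `j` and `k` replaced by `R` and `R'`. -/
def replaceColumns (D : Diagram n) (j k : Fin n) (R R' : Finset (Fin n)) : Diagram n :=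
  Function.update (Function.update D j R) k R'

lemma replaceColumns_left {D : Diagram n} {j k : Fin n} (hjk : j ≠ k) (R R' : Finset (Fin n)) :
    replaceColumns D j k R R' j = R := by
  simp [replaceColumns, hjk]

lemma replaceColumns_right {D : Diagram n} {j k : Fin n} (R R' : Finset (Fin n)) :
    replaceColumns D j k R R' k = R' := by
  simp [replaceColumns]

lemma replaceColumns_of_ne {D : Diagram n} {j k m : Fin n} (hj : m ≠ j) (hk : m ≠ k)
    (R R' : Finset (Fin n)) : replaceColumns D j k R R' m = D m := by
  simp [replaceColumns, hj, hk]

lemma rowCount_replaceColumns {D : Diagram n} {j k : Fin n} (hjk : j ≠ k)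
    (R R' : Finset (Fin n)) (i : Fin n) :
    rowCount univ (replaceColumns D j k R R') i =
      (if i ∈ R then 1 else 0) + (if i ∈ R' then 1 else 0) +
        rowCount ((univ.erase j).erase k) D i := by
  rw [rowCount, rowCount, card_filter, card_filter, ← add_sum_erase _ _ (mem_univ j),
    ← add_sum_erase _ _ (mem_erase.2 ⟨hjk.symm, mem_univ k⟩), replaceColumns_left hjk,
    replaceColumns_right, add_assoc]
  congr 2
  refine sum_congr rfl fun m hm => ?_
  simp only [mem_erase, mem_univ, and_true] at hm
  rw [replaceColumns_of_ne hm.2 hm.1]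

lemma evalAt_detY_replaceColumns_ne_zero {D : Diagram n} {j k : Fin n} (hjk : j ≠ k)
    {R R' : Finset (Fin n)} {l : List (Fin n × Fin n)} (hl : ∀ e ∈ l, e.1 < e.2)
    (h : IsNonsingularMinor l R (D j)) (h' : IsNonsingularMinor l R' (D k)) :
    DiagramLE (replaceColumns D j k R R') D ∧
      evalAt (onePlusUnits l) (detY (replaceColumns D j k R R') D) ≠ 0 := by
  have key : ∀ m, evalAt (onePlusUnits l) (minorY (replaceColumns D j k R R' m) (D m)) ≠ 0 := by
    intro m
    by_cases hk : m = k
    · subst hk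
      rw [replaceColumns_right]
      exact h'.evalAt_ne_zero hl
    by_cases hj : m = j
    · subst hj
      rw [replaceColumns_left hjk]
      exact h.evalAt_ne_zero hl
    · rw [replaceColumns_of_ne hj hk]
      exact evalAt_onePlusUnits_minorY_self_ne_zero hl _
  refine ⟨fun m => galeLE_of_evalAt_ne_zero (blockTriangular_onePlusUnits hl) (key m), ?_⟩
  rw [detY, map_prod]
  exact prod_ne_zero_iff.2 fun m _ => key m

/-- Two ways `(P₁, Q₁)`, `(P₂, Q₂)` of moving boxes in two columns of `D` that have the same
weight and are told apart by two unipotent matrices. -/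
lemma not_isZeroOne_of_columns {D : Diagram n} {j k : Fin n} (hjk : j ≠ k)
    (P₁ Q₁ P₂ Q₂ : Finset (Fin n)) (l₁ l₂ : List (Fin n × Fin n))
    (hl₁ : ∀ e ∈ l₁, e.1 < e.2) (hl₂ : ∀ e ∈ l₂, e.1 < e.2)
    (hw : ∀ i, (if i ∈ P₁ then 1 else 0) + (if i ∈ Q₁ then 1 else 0) =
      (if i ∈ P₂ then 1 else 0) + (if i ∈ Q₂ then 1 else 0))
    (hP₁ : IsNonsingularMinor l₁ P₁ (D j)) (hQ₁ : IsNonsingularMinor l₁ Q₁ (D k))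
    (hP₂ : IsNonsingularMinor l₂ P₂ (D j)) (hQ₂ : IsNonsingularMinor l₂ Q₂ (D k))
    (h0 : (∃ s ∈ D j, ∀ i ∈ P₂, onePlusUnits l₁ i s = 0) ∨
      ∃ s ∈ D k, ∀ i ∈ Q₂, onePlusUnits l₁ i s = 0) :
    ¬ IsZeroOne (dualCharacter D) := by
  obtain ⟨hle₁, hne₁⟩ := evalAt_detY_replaceColumns_ne_zero hjk hl₁ hP₁ hQ₁
  obtain ⟨hle₂, hne₂⟩ := evalAt_detY_replaceColumns_ne_zero hjk hl₂ hP₂ hQ₂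
  refine not_isZeroOne_of_evalAt hle₁ hle₂ (funext fun i => ?_) hne₁ ?_ hne₂
  · rw [rowCount_replaceColumns hjk, rowCount_replaceColumns hjk, hw]
  · have hM := blockTriangular_onePlusUnits hl₁
    rw [detY, map_prod]
    rcases h0 with ⟨s, hs, h⟩ | ⟨s, hs, h⟩
    · refine prod_eq_zero (mem_univ j) (evalAt_minorY_eq_zero hM hs ?_)
      rwa [replaceColumns_left hjk]
    · refine prod_eq_zero (mem_univ k) (evalAt_minorY_eq_zero hM hs ?_)
      rwa [replaceColumns_right]

/-- The set `S` with the element `b` replaced by `a`. -/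
def moveTo (a b : Fin n) (S : Finset (Fin n)) : Finset (Fin n) := insert a (S.erase b)

lemma mem_moveTo {a b i : Fin n} {S : Finset (Fin n)} :
    i ∈ moveTo a b S ↔ i = a ∨ i ≠ b ∧ i ∈ S := by simp [moveTo]

lemma card_moveTo {a b : Fin n} {S : Finset (Fin n)} (ha : a ∉ S) (hb : b ∈ S) :
    #(moveTo a b S) = #S := by
  rw [moveTo, card_insert_of_notMem (fun h => ha (mem_of_mem_erase h)), card_erase_add_one hb]

/-- In each configuration, boxes of the two columns are moved up within the rows of the
configuration in two ways of the same weight. At the first matrix the second product of minors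
vanishes because one of its factors has a zero column. -/
lemma not_isZeroOne_of_containsConfig {D : Diagram n} {j k : Fin n} (hjk : j ≠ k)
    (h : ContainsConfig (D j) (D k)) : ¬ IsZeroOne (dualCharacter D) := by
  cases h with
  | A i₁ i₂ i₃ h₁₂ h₂₃ r₁ r₂ r₃ =>
    have h₁₃ := h₁₂.trans h₂₃
    refine not_isZeroOne_of_columns hjk (D j) (moveTo i₁ i₃ (D k))
      (moveTo i₁ i₂ (D j)) (moveTo i₂ i₃ (D k)) [(i₁, i₃)] [(i₁, i₂), (i₂, i₃)]
      (by simp [*]) (by simp [*])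
      (fun i => by simp only [mem_moveTo]; grind)
      ⟨rfl, fun v h0 h1 i => ?_⟩
      ⟨card_moveTo (by tauto) (by tauto), fun v h0 h1 i => ?_⟩
      ⟨card_moveTo (by tauto) (by tauto), fun v h0 h1 i => ?_⟩
      ⟨card_moveTo (by tauto) (by tauto), fun v h0 h1 i => ?_⟩
      (Or.inl ⟨i₂, by tauto, fun i hi => ?_⟩)
    all_goals
      simp only [onePlusUnits_apply, mem_moveTo, List.map_cons, List.map_nil, List.sum_cons,
        List.sum_nil] at *
      grind
  | B i₁ i₂ i₃ i₄ h₁₂ h₂₃ h₃₄ r₁ r₂ r₃ r₄ =>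
    have h₁₃ := h₁₂.trans h₂₃
    have h₂₄ := h₂₃.trans h₃₄
    have h₁₄ := h₁₂.trans h₂₄
    refine not_isZeroOne_of_columns hjk (moveTo i₂ i₄ (moveTo i₁ i₃ (D j))) (D k)
      (moveTo i₁ i₄ (D j)) (moveTo i₂ i₃ (D k)) [(i₁, i₃), (i₂, i₄)] [(i₁, i₄), (i₂, i₃)]
      (by simp [*]) (by simp [*])
      (fun i => by simp only [mem_moveTo]; grind)
      ⟨(card_moveTo (by simp only [mem_moveTo]; grind) (by simp only [mem_moveTo]; grind)).trans
        (card_moveTo (by tauto) (by tauto)), fun v h0 h1 i => ?_⟩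
      ⟨rfl, fun v h0 h1 i => ?_⟩
      ⟨card_moveTo (by tauto) (by tauto), fun v h0 h1 i => ?_⟩
      ⟨card_moveTo (by tauto) (by tauto), fun v h0 h1 i => ?_⟩
      (Or.inl ⟨i₄, by tauto, fun i hi => ?_⟩)
    all_goals
      simp only [onePlusUnits_apply, mem_moveTo, List.map_cons, List.map_nil, List.sum_cons,
        List.sum_nil] at *
      grind
  | C i₁ i₂ i₃ i₄ h₁₂ h₂₃ h₃₄ r₁ r₂ r₃ r₄ =>
    have h₁₃ := h₁₂.trans h₂₃
    have h₂₄ := h₂₃.trans h₃₄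
    have h₁₄ := h₁₂.trans h₂₄
    refine not_isZeroOne_of_columns hjk (moveTo i₁ i₄ (D j)) (moveTo i₂ i₃ (D k))
      (moveTo i₂ i₄ (D j)) (moveTo i₁ i₃ (D k)) [(i₁, i₄), (i₂, i₃)] [(i₁, i₃), (i₂, i₄)]
      (by simp [*]) (by simp [*])
      (fun i => by simp only [mem_moveTo]; grind)
      ⟨card_moveTo (by tauto) (by tauto), fun v h0 h1 i => ?_⟩
      ⟨card_moveTo (by tauto) (by tauto), fun v h0 h1 i => ?_⟩
      ⟨card_moveTo (by tauto) (by tauto), fun v h0 h1 i => ?_⟩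
      ⟨card_moveTo (by tauto) (by tauto), fun v h0 h1 i => ?_⟩
      (Or.inl ⟨i₄, by tauto, fun i hi => ?_⟩)
    all_goals
      simp only [onePlusUnits_apply, mem_moveTo, List.map_cons, List.map_nil, List.sum_cons,
        List.sum_nil] at *
      grind
  | D i₁ i₂ i₃ h₁₂ h₂₃ r₁ r₂ r₃ =>
    have h₁₃ := h₁₂.trans h₂₃
    refine not_isZeroOne_of_columns hjk (moveTo i₁ i₃ (D j)) (D k)
      (moveTo i₁ i₂ (D j)) (moveTo i₂ i₃ (D k)) [(i₁, i₃)] [(i₁, i₂), (i₂, i₃)]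
      (by simp [*]) (by simp [*])
      (fun i => by simp only [mem_moveTo]; grind)
      ⟨card_moveTo (by tauto) (by tauto), fun v h0 h1 i => ?_⟩
      ⟨rfl, fun v h0 h1 i => ?_⟩
      ⟨card_moveTo (by tauto) (by tauto), fun v h0 h1 i => ?_⟩
      ⟨card_moveTo (by tauto) (by tauto), fun v h0 h1 i => ?_⟩
      (Or.inl ⟨i₂, by tauto, fun i hi => ?_⟩)
    all_goals
      simp only [onePlusUnits_apply, mem_moveTo, List.map_cons, List.map_nil, List.sum_cons,
        List.sum_nil] at *
      grind
  | E i₁ i₂ i₃ i₄ h₁₂ h₂₃ h₃₄ r₁ r₂ r₃ r₄ =>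
    have h₁₃ := h₁₂.trans h₂₃
    have h₂₄ := h₂₃.trans h₃₄
    have h₁₄ := h₁₂.trans h₂₄
    refine not_isZeroOne_of_columns hjk (moveTo i₁ i₃ (D j)) (moveTo i₃ i₄ (D k))
      (moveTo i₁ i₂ (D j)) (moveTo i₂ i₄ (D k)) [(i₁, i₃), (i₃, i₄)] [(i₁, i₂), (i₂, i₄)]
      (by simp [*]) (by simp [*])
      (fun i => by simp only [mem_moveTo]; grind)
      ⟨card_moveTo (by tauto) (by tauto), fun v h0 h1 i => ?_⟩
      ⟨card_moveTo (by tauto) (by tauto), fun v h0 h1 i => ?_⟩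
      ⟨card_moveTo (by tauto) (by tauto), fun v h0 h1 i => ?_⟩
      ⟨card_moveTo (by tauto) (by tauto), fun v h0 h1 i => ?_⟩
      (Or.inl ⟨i₂, by tauto, fun i hi => ?_⟩)
    all_goals
      simp only [onePlusUnits_apply, mem_moveTo, List.map_cons, List.map_nil, List.sum_cons,
        List.sum_nil] at *
      grind
  | F i₁ i₂ i₃ i₄ h₁₂ h₂₃ h₃₄ r₁ r₂ r₃ r₄ =>
    have h₁₃ := h₁₂.trans h₂₃
    have h₂₄ := h₂₃.trans h₃₄
    have h₁₄ := h₁₂.trans h₂₄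
    refine not_isZeroOne_of_columns hjk (moveTo i₂ i₃ (D j)) (moveTo i₃ i₄ (moveTo i₁ i₂ (D k)))
      (D j) (moveTo i₁ i₄ (D k)) [(i₁, i₂), (i₂, i₃), (i₃, i₄)] [(i₁, i₄)]
      (by simp [*]) (by simp [*])
      (fun i => by simp only [mem_moveTo]; grind)
      ⟨card_moveTo (by tauto) (by tauto), fun v h0 h1 i => ?_⟩
      ⟨(card_moveTo (by simp only [mem_moveTo]; grind) (by simp only [mem_moveTo]; grind)).trans
        (card_moveTo (by tauto) (by tauto)), fun v h0 h1 i => ?_⟩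
      ⟨rfl, fun v h0 h1 i => ?_⟩
      ⟨card_moveTo (by tauto) (by tauto), fun v h0 h1 i => ?_⟩
      (Or.inr ⟨i₄, by tauto, fun i hi => ?_⟩)
    all_goals
      simp only [onePlusUnits_apply, mem_moveTo, List.map_cons, List.map_nil, List.sum_cons,
        List.sum_nil] at *
      grind

end Configurations

/-! ### Columns with the same first gap -/

section Base

variable {n : ℕ} {ι : Type*}

lemma sum_card_eq_sum_rowCount (J : Finset ι) (A : ι → Finset (Fin n)) :
    ∑ j ∈ J, #(A j) = ∑ i, rowCount J A i := by
  simp only [rowCount, card_filter]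
  rw [sum_comm]
  refine sum_congr rfl fun j _ => ?_
  simp

/-- The elements of `[n]` in the half-open interval `[b, h)`. -/
def seg (n b h : ℕ) : Finset (Fin n) := univ.filter fun i => b ≤ (i : ℕ) ∧ (i : ℕ) < h

@[simp] lemma mem_seg {b h : ℕ} {i : Fin n} : i ∈ seg n b h ↔ b ≤ (i : ℕ) ∧ (i : ℕ) < h := by
  simp [seg]

lemma card_seg {b : Fin n} {h : ℕ} (hb : (b : ℕ) < h) :
    #(seg n b h) = #(seg n (b + 1) h) + 1 := by
  have : seg n b h = insert b (seg n (b + 1) h) := by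
    ext i
    simp only [mem_seg, mem_insert, Fin.ext_iff]
    omega
  rw [this, card_insert_of_notMem (by simp)]

/-- The rows in `[b, h)` that `E` misses. -/
def holes (b h : ℕ) (E : Finset (Fin n)) : Finset (Fin n) := seg n b h \ E

lemma rowCount_holes (J : Finset ι) (b h : ℕ) {E E' : ι → Finset (Fin n)}
    (hw : rowCount J E = rowCount J E') :
    rowCount J (fun j => holes b h (E j)) = rowCount J (fun j => holes b h (E' j)) := by
  funext i
  by_cases hi : i ∈ seg n b h
  · have key : ∀ A : ι → Finset (Fin n),
        rowCount J A i + rowCount J (fun j => holes b h (A j)) i = #J := fun A => by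
      rw [← card_filter_add_card_filter_not (s := J) fun j => i ∈ A j]
      refine congrArg _ (congrArg card (filter_congr fun j _ => ?_))
      simp only [holes, mem_sdiff, hi, true_and]
    have h1 := key E
    have h2 := key E'
    rw [hw] at h1
    omega
  · have key : ∀ A : ι → Finset (Fin n), rowCount J (fun j => holes b h (A j)) i = 0 := fun A => by
      rw [rowCount, card_eq_zero, filter_eq_empty_iff]
      intro j _ hj
      exact hi (mem_sdiff.1 hj).1
    rw [key, key]

section Hole

variable {b : Fin n} {h : ℕ} {E T : Finset (Fin n)}

lemma lo_eq_seg_sdiff_holes (hE : ∀ x ∈ E, b ≤ x) : lo h E = seg n b h \ holes b h E := by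
  ext i
  simp only [mem_lo, holes, mem_sdiff, mem_seg]
  have := hE i
  rw [Fin.le_def] at this
  tauto

lemma card_lo_add_card_holes (hE : ∀ x ∈ E, b ≤ x) :
    #(lo h E) + #(holes b h E) = #(seg n b h) := by
  rw [lo_eq_seg_sdiff_holes hE]
  exact card_sdiff_add_card_eq_card sdiff_subset

/-- Below a column `T` whose only gap in `[b, h)` is `b`, there is at most one hole in `[b, h)`. -/
lemma card_holes_le_one (hb : (b : ℕ) < h) (hT : lo h T = seg n (b + 1) h) (hET : GaleLE E T)
    (hE : ∀ x ∈ E, b ≤ x) : #(holes b h E) ≤ 1 := by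
  have h1 := card_lo_add_card_holes (h := h) hE
  have h2 := hET.card_lo_le h
  rw [hT] at h2
  have := card_seg hb
  omega

/-- The number of holes records whether a box has crossed the horizontal line at height `h`. -/
lemma card_hi_add_one (hb : (b : ℕ) < h) (hT : lo h T = seg n (b + 1) h) (hET : GaleLE E T)
    (hE : ∀ x ∈ E, b ≤ x) : #(hi h E) + 1 = #(hi h T) + #(holes b h E) := by
  have h1 := card_lo_add_card_holes (h := h) hE
  have h2 := card_lo_add_card_hi h E
  have h3 := card_lo_add_card_hi h T
  rw [hT] at h3
  have := card_seg hb
  have := hET.card_eq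
  omega

/-- The part of the minor below height `h` if `E` has a hole in `[b, h)`, that is, if the minor
splits at height `h`; the whole minor otherwise. -/
def lowerFactor (b h : ℕ) (E T : Finset (Fin n)) : YPoly n :=
  if holes b h E = ∅ then minorY E T else minorY (hi h E) (hi h T)

lemma minorY_eq_prod_holes_mul (hb : (b : ℕ) < h) (hT : lo h T = seg n (b + 1) h)
    (hET : GaleLE E T) (hE : ∀ x ∈ E, b ≤ x) :
    minorY E T = (∏ x ∈ holes b h E, minorY ((seg n b h).erase x) (seg n (b + 1) h)) *
      lowerFactor b h E T := by
  have h1 := card_holes_le_one hb hT hET hE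
  by_cases h0 : holes b h E = ∅
  · rw [lowerFactor, if_pos h0, h0, prod_empty, one_mul]
  · have h2 : #(holes b h E) = 1 := le_antisymm h1 (card_pos.2 (nonempty_iff_ne_empty.2 h0))
    have h3 := card_hi_add_one hb hT hET hE
    have h4 := card_lo_add_card_hi h E
    have h5 := card_lo_add_card_hi h T
    have h6 := hET.card_eq
    rw [lowerFactor, if_neg h0, minorY_split h (by omega), hT, lo_eq_seg_sdiff_holes hE]
    obtain ⟨x, hx⟩ := card_eq_one.1 h2
    rw [hx, prod_singleton, sdiff_singleton_eq_erase]

end Hole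

/-- The equality of products of minors, for columns without gaps strictly between `b` and `h`. The
multiset of holes in `[b, h)` is determined by the row counts, and so is everything below `h`, as
soon as either at most one column reaches below `h`, or all those that do so contain a single box
there, in the same row `m`. -/
lemma prod_minorY_eq_of_lo_eq_seg (J : Finset ι) {b : Fin n} {h : ℕ} (hb : (b : ℕ) < h)
    {T E E' : ι → Finset (Fin n)} (hT : ∀ j ∈ J, lo h (T j) = seg n (b + 1) h)
    (hET : ∀ j ∈ J, GaleLE (E j) (T j)) (hE : ∀ j ∈ J, ∀ x ∈ E j, b ≤ x)
    (hET' : ∀ j ∈ J, GaleLE (E' j) (T j)) (hE' : ∀ j ∈ J, ∀ x ∈ E' j, b ≤ x)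
    (hw : rowCount J E = rowCount J E')
    (htail : (∃ j₀ ∈ J, ∀ j ∈ J, j ≠ j₀ → hi h (T j) = ∅) ∨
      ∃ m, ∀ j ∈ J, hi h (T j) = ∅ ∨ hi h (T j) = {m}) :
    ∏ j ∈ J, minorY (E j) (T j) = ∏ j ∈ J, minorY (E' j) (T j) := by
  have hsplit : ∀ F : ι → Finset (Fin n), (∀ j ∈ J, GaleLE (F j) (T j)) →
      (∀ j ∈ J, ∀ x ∈ F j, b ≤ x) → ∏ j ∈ J, minorY (F j) (T j) =
        (∏ j ∈ J, ∏ x ∈ holes b h (F j), minorY ((seg n b h).erase x) (seg n (b + 1) h)) *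
          ∏ j ∈ J, lowerFactor b h (F j) (T j) := fun F h1 h2 => by
    rw [← prod_mul_distrib]
    exact prod_congr rfl fun j hj => minorY_eq_prod_holes_mul hb (hT j hj) (h1 j hj) (h2 j hj)
  have hwh := rowCount_holes J b h hw
  rw [hsplit E hET hE, hsplit E' hET' hE', prod_prod_eq_prod_pow_rowCount,
    prod_prod_eq_prod_pow_rowCount, hwh]
  congr 1
  -- columns that end above `h` keep their hole
  have hempty : ∀ F : Finset (Fin n), ∀ j ∈ J, GaleLE F (T j) → (∀ x ∈ F, b ≤ x) →
      hi h (T j) = ∅ → hi h F = ∅ ∧ holes b h F ≠ ∅ := fun F j hj h1 h2 h3 => by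
    have h4 := card_hi_add_one hb (hT j hj) h1 h2
    have h5 := h1.card_hi_le h
    rw [h3, card_empty] at h4 h5
    refine ⟨card_eq_zero.1 (by omega), fun h0 => ?_⟩
    rw [h0, card_empty] at h4
    omega
  rcases htail with ⟨j₀, hj₀, htail⟩ | ⟨m, htail⟩
  · refine prod_congr rfl fun j hj => ?_
    by_cases hjj : j = j₀
    · subst hjj
      have key : ∀ F : ι → Finset (Fin n), (∀ j ∈ J, GaleLE (F j) (T j)) →
          (∀ j ∈ J, ∀ x ∈ F j, b ≤ x) →
          hi h (F j) = univ.filter fun i : Fin n => h ≤ (i : ℕ) ∧ 0 < rowCount J F i := by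
        intro F h1 h2
        ext i
        simp only [mem_hi, mem_filter, mem_univ, true_and, rowCount, card_pos]
        constructor
        · rintro ⟨hi, hhi⟩
          exact ⟨hhi, j, mem_filter.2 ⟨hj, hi⟩⟩
        · rintro ⟨hhi, k, hk⟩
          rw [mem_filter] at hk
          have : k = j := by
            by_contra hkj
            have := (hempty (F k) k hk.1 (h1 k hk.1) (h2 k hk.1) (htail k hk.1 hkj)).1
            exact notMem_empty i (this ▸ mem_hi.2 ⟨hk.2, hhi⟩)
          exact ⟨this ▸ hk.2, hhi⟩
      have hhi : hi h (E j) = hi h (E' j) := by rw [key E hET hE, key E' hET' hE', hw]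
      have h1 := card_hi_add_one hb (hT j hj) (hET j hj) (hE j hj)
      have h2 := card_hi_add_one hb (hT j hj) (hET' j hj) (hE' j hj)
      rw [hhi] at h1
      have h3 : #(holes b h (E j)) = #(holes b h (E' j)) := by omega
      by_cases h0 : holes b h (E j) = ∅
      · have h0' : holes b h (E' j) = ∅ := by rwa [← card_eq_zero, ← h3, card_eq_zero]
        have : E j = E' j := by
          rw [← lo_union_hi h (E j), ← lo_union_hi h (E' j), hhi,
            lo_eq_seg_sdiff_holes (hE j hj), lo_eq_seg_sdiff_holes (hE' j hj), h0, h0']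
        rw [this]
      · have h0' : holes b h (E' j) ≠ ∅ := by rwa [Ne, ← card_eq_zero, ← h3, card_eq_zero]
        rw [lowerFactor, lowerFactor, if_neg h0, if_neg h0', hhi]
    · obtain ⟨h1, h2⟩ := hempty (E j) j hj (hET j hj) (hE j hj) (htail j hj hjj)
      obtain ⟨h1', h2'⟩ := hempty (E' j) j hj (hET' j hj) (hE' j hj) (htail j hj hjj)
      rw [lowerFactor, lowerFactor, if_neg h2, if_neg h2', h1, h1']
  · have key : ∀ F : ι → Finset (Fin n), (∀ j ∈ J, GaleLE (F j) (T j)) →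
        (∀ j ∈ J, ∀ x ∈ F j, b ≤ x) → ∏ j ∈ J, lowerFactor b h (F j) (T j) =
          (∏ j ∈ J, ∏ x ∈ hi h (F j), matY n x m) *
            minorY (seg n b h) (seg n (b + 1) h ∪ {m}) ^ #{j ∈ J | holes b h (F j) = ∅} := by
      intro F h1 h2
      rw [← prod_const, prod_filter, ← prod_mul_distrib]
      refine prod_congr rfl fun j hj => ?_
      rcases htail j hj with h3 | h3
      · obtain ⟨h4, h5⟩ := hempty (F j) j hj (h1 j hj) (h2 j hj) h3
        rw [lowerFactor, if_neg h5, if_neg h5, h4, h3, minorY_empty, prod_empty, one_mul]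
      · have h4 := card_hi_add_one hb (hT j hj) (h1 j hj) (h2 j hj)
        rw [h3, card_singleton] at h4
        by_cases h0 : holes b h (F j) = ∅
        · rw [h0, card_empty] at h4
          have h5 : hi h (F j) = ∅ := card_eq_zero.1 (by omega)
          have h6 : F j = seg n b h := by
            rw [← lo_union_hi h (F j), lo_eq_seg_sdiff_holes (h2 j hj), h0, h5, union_empty,
              sdiff_empty]
          have h7 : T j = seg n (b + 1) h ∪ {m} := by
            rw [← lo_union_hi h (T j), hT j hj, h3]
          rw [lowerFactor, if_pos h0, if_pos h0, h5, prod_empty, one_mul, h6, h7]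
        · have h5 := card_holes_le_one hb (hT j hj) (h1 j hj) (h2 j hj)
          have h6 := card_pos.2 (nonempty_iff_ne_empty.2 h0)
          obtain ⟨r, hr⟩ := card_eq_one.1 (show #(hi h (F j)) = 1 by omega)
          rw [lowerFactor, if_neg h0, if_neg h0, hr, h3, minorY_singleton, prod_singleton, mul_one]
    have hcount : ∀ F : ι → Finset (Fin n), (∀ j ∈ J, GaleLE (F j) (T j)) →
        (∀ j ∈ J, ∀ x ∈ F j, b ≤ x) → #{j ∈ J | holes b h (F j) = ∅} +
          ∑ i, rowCount J (fun j => holes b h (F j)) i = #J := by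
      intro F h1 h2
      rw [← sum_card_eq_sum_rowCount, card_filter, ← sum_add_distrib, card_eq_sum_ones]
      refine sum_congr rfl fun j hj => ?_
      have h5 := card_holes_le_one hb (hT j hj) (h1 j hj) (h2 j hj)
      split_ifs with h0
      · rw [h0, card_empty]
      · have h6 := card_pos.2 (nonempty_iff_ne_empty.2 h0)
        omega
    have hhi : rowCount J (fun j => hi h (E j)) = rowCount J (fun j => hi h (E' j)) := by
      funext i
      have hwi := congrFun hw i
      simp only [rowCount, mem_hi] at hwi ⊢
      by_cases hh : h ≤ (i : ℕ)
      · simpa only [hh, and_true] using hwi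
      · simp only [hh, and_false]
    have h1 := hcount E hET hE
    have h2 := hcount E' hET' hE'
    rw [hwh] at h1
    rw [key E hET hE, key E' hET' hE', prod_prod_eq_prod_pow_rowCount,
      prod_prod_eq_prod_pow_rowCount, hhi,
      show #{j ∈ J | holes b h (E j) = ∅} = #{j ∈ J | holes b h (E' j) = ∅} by omega]

end Base

section Chain

variable {n : ℕ} {ι : Type*}

lemma GaleLE.lt_of_forall_lt {E T : Finset (Fin n)} (hET : GaleLE E T) {k : ℕ}
    (hT : ∀ y ∈ T, (y : ℕ) < k) : ∀ y ∈ E, (y : ℕ) < k := by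
  have h1 : hi k T = ∅ := by
    rw [eq_empty_iff_forall_notMem]
    intro y hy
    rw [mem_hi] at hy
    have := hT y hy.1
    omega
  have h2 := hET.card_hi_le k
  rw [h1, card_empty, Nat.le_zero, card_eq_zero] at h2
  intro y hy
  by_contra! hk
  exact notMem_empty y (h2 ▸ mem_hi.2 ⟨hy, hk⟩)

lemma card_lo_union_of_disjoint {E X : Finset (Fin n)} (h : Disjoint E X) (k : ℕ) :
    #(lo k (E ∪ X)) = #(lo k E) + #(lo k X) := by
  rw [lo, filter_union, card_union_of_disjoint (disjoint_filter_filter h)]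
  rfl

/-- Appending the same set `X` of lower rows to both members of a Gale pair. -/
lemma GaleLE.union {E T X : Finset (Fin n)} (hET : GaleLE E T) (hX : ∀ x ∈ X, ∀ y ∈ T, y < x) :
    Disjoint E X ∧ GaleLE (E ∪ X) (T ∪ X) ∧
      minorY (E ∪ X) (T ∪ X) = minorY E T * minorY X X := by
  have hXE : ∀ x ∈ X, ∀ y ∈ E, y < x := fun x hx y hy =>
    hET.lt_of_forall_lt (fun z hz => hX x hx z hz) y hy
  have hT : Disjoint T X := disjoint_left.2 fun y hy hy' => (hX y hy' y hy).false
  have hE : Disjoint E X := disjoint_left.2 fun y hy hy' => (hXE y hy' y hy).false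
  refine ⟨hE, galeLE_iff.2 ⟨?_, fun k => ?_⟩, ?_⟩
  · rw [card_union_of_disjoint hE, card_union_of_disjoint hT, hET.card_eq]
  · rw [card_lo_union_of_disjoint hE, card_lo_union_of_disjoint hT]
    have := hET.card_lo_le k
    omega
  · rcases X.eq_empty_or_nonempty with rfl | hne
    · rw [union_empty, union_empty, minorY_empty, mul_one]
    · have key : ∀ F : Finset (Fin n), (∀ x ∈ X, ∀ y ∈ F, y < x) →
          lo (X.min' hne) (F ∪ X) = F ∧ hi (X.min' hne) (F ∪ X) = X := by
        intro F hF
        have h1 : ∀ y ∈ F, y < X.min' hne := hF _ (X.min'_mem hne)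
        have h2 : ∀ y ∈ X, X.min' hne ≤ y := fun y hy => X.min'_le y hy
        constructor
        · ext y
          have h1 := h1 y
          have h2 := h2 y
          rw [Fin.lt_def] at h1
          rw [Fin.le_def] at h2
          rw [mem_lo, mem_union]
          constructor
          · rintro ⟨h | h, h'⟩
            · exact h
            · have := h2 h
              omega
          · exact fun h => ⟨Or.inl h, h1 h⟩
        · ext y
          have h1 := h1 y
          have h2 := h2 y
          rw [Fin.lt_def] at h1
          rw [Fin.le_def] at h2
          rw [mem_hi, mem_union]
          constructor
          · rintro ⟨h | h, h'⟩
            · have := h1 h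
              omega
            · exact h
          · exact fun h => ⟨Or.inr h, h2 h⟩
      obtain ⟨h1, h2⟩ := key E hXE
      obtain ⟨h3, h4⟩ := key T hX
      rw [minorY_split (X.min' hne) (by rw [h1, h3, hET.card_eq]), h1, h2, h3, h4]

lemma rowCount_union (J : Finset ι) {E X : ι → Finset (Fin n)}
    (h : ∀ j ∈ J, Disjoint (E j) (X j)) (i : Fin n) :
    rowCount J (fun j => E j ∪ X j) i = rowCount J E i + rowCount J X i := by
  classical
  simp only [rowCount, mem_union]
  rw [filter_or, card_union_of_disjoint]
  rw [disjoint_filter]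
  exact fun j hj h1 h2 => disjoint_left.1 (h j hj) h1 h2

/-- `prod_minorY_eq_of_lo_eq_seg` for columns that may also end before `h`: these are first filled
up to height `h`. -/
lemma prod_minorY_eq_of_seg (J : Finset ι) {b : Fin n} {h : ℕ} (hb : (b : ℕ) < h)
    {T E E' : ι → Finset (Fin n)} (hTb : ∀ j ∈ J, ∀ x ∈ T j, b < x)
    (hT : ∀ j ∈ J, ∀ x ∈ seg n (b + 1) h \ T j, ∀ y ∈ T j, y < x)
    (hET : ∀ j ∈ J, GaleLE (E j) (T j)) (hE : ∀ j ∈ J, ∀ x ∈ E j, b ≤ x)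
    (hET' : ∀ j ∈ J, GaleLE (E' j) (T j)) (hE' : ∀ j ∈ J, ∀ x ∈ E' j, b ≤ x)
    (hw : rowCount J E = rowCount J E')
    (htail : (∃ j₀ ∈ J, ∀ j ∈ J, j ≠ j₀ → hi h (T j) = ∅) ∨
      ∃ m, ∀ j ∈ J, hi h (T j) = ∅ ∨ hi h (T j) = {m}) :
    ∏ j ∈ J, minorY (E j) (T j) = ∏ j ∈ J, minorY (E' j) (T j) := by
  let X : ι → Finset (Fin n) := fun j => seg n (b + 1) h \ T j
  have hX : ∀ j, T j ∪ X j = T j ∪ seg n (b + 1) h := fun j => union_sdiff_self_eq_union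
  have hlo : ∀ j ∈ J, lo h (T j ∪ X j) = seg n (b + 1) h := fun j hj => by
    rw [hX]
    ext x
    simp only [mem_lo, mem_union, mem_seg]
    have := hTb j hj x
    rw [Fin.lt_def] at this
    constructor
    · rintro ⟨hx | hx, h'⟩
      · exact ⟨this hx, h'⟩
      · exact hx
    · exact fun hx => ⟨Or.inr hx, hx.2⟩
  have hhi : ∀ j, hi h (T j ∪ X j) = hi h (T j) := fun j => by
    rw [hX]
    ext x
    simp only [mem_hi, mem_union, mem_seg]
    constructor
    · rintro ⟨hx | hx, h'⟩
      · exact ⟨hx, h'⟩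
      · omega
    · exact fun hx => ⟨Or.inl hx.1, hx.2⟩
  have hXb : ∀ F : ι → Finset (Fin n), (∀ j ∈ J, ∀ x ∈ F j, b ≤ x) →
      ∀ j ∈ J, ∀ x ∈ F j ∪ X j, b ≤ x := fun F hF j hj x hx => by
    rcases mem_union.1 hx with hx | hx
    · exact hF j hj x hx
    · have := (mem_seg.1 (mem_sdiff.1 hx).1).1
      exact Fin.le_def.2 (by omega)
  have hmain := prod_minorY_eq_of_lo_eq_seg J hb (T := fun j => T j ∪ X j)
    (E := fun j => E j ∪ X j) (E' := fun j => E' j ∪ X j) hlo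
    (fun j hj => ((hET j hj).union (hT j hj)).2.1) (hXb E hE)
    (fun j hj => ((hET' j hj).union (hT j hj)).2.1) (hXb E' hE')
    (funext fun i => by
      rw [rowCount_union J fun j hj => ((hET j hj).union (hT j hj)).1,
        rowCount_union J fun j hj => ((hET' j hj).union (hT j hj)).1, hw])
    (by simpa only [hhi] using htail)
  rw [prod_congr rfl fun j hj => ((hET j hj).union (hT j hj)).2.2,
    prod_congr rfl fun j hj => ((hET' j hj).union (hT j hj)).2.2, prod_mul_distrib,
    prod_mul_distrib] at hmain
  exact mul_right_cancel₀ (prod_ne_zero_iff.2 fun j _ => minorY_self_ne_zero (X j)) hmain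

/-- The equality of products of minors, for columns `T j` that have their first gap at `b` and
contain no configuration (A) or (C): the columns form a chain of initial parts, and the gaps are
so restricted that `prod_minorY_eq_of_seg` applies. -/
lemma prod_minorY_eq_of_chain (J : Finset ι) {b : Fin n} {T E E' : ι → Finset (Fin n)}
    (hTb : ∀ j ∈ J, ∀ x ∈ T j, b < x)
    (hA : ∀ j ∈ J, ∀ k ∈ J, j ≠ k → ∀ x ∈ T j, x ∉ T k → ∀ y ∈ T k, y < x)
    (hC : ∀ j ∈ J, ∀ k ∈ J, j ≠ k → ∀ c x y, b < c → c ∉ T j → c ∉ T k → c < x → x ∈ T j →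
      x ∈ T k → x < y → y ∉ T j)
    (hET : ∀ j ∈ J, GaleLE (E j) (T j)) (hE : ∀ j ∈ J, ∀ x ∈ E j, b ≤ x)
    (hET' : ∀ j ∈ J, GaleLE (E' j) (T j)) (hE' : ∀ j ∈ J, ∀ x ∈ E' j, b ≤ x)
    (hw : rowCount J E = rowCount J E') :
    ∏ j ∈ J, minorY (E j) (T j) = ∏ j ∈ J, minorY (E' j) (T j) := by
  classical
  rcases J.eq_empty_or_nonempty with rfl | hne
  · simp
  obtain ⟨j₀, hj₀, hmax⟩ := exists_max_image J (fun j => #(T j)) hne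
  -- the columns form a chain, with `T j₀` as the longest one
  have hsub : ∀ j ∈ J, T j ⊆ T j₀ := by
    intro j hj x hx
    by_contra hx0
    have hjj : j ≠ j₀ := fun h => hx0 (h ▸ hx)
    have h1 := hA j hj j₀ hj₀ hjj x hx hx0
    have h2 : T j₀ ⊆ T j := by
      intro y hy
      by_contra hy0
      exact lt_asymm (h1 y hy) (hA j₀ hj₀ j hj hjj.symm y hy hy0 x hx)
    have h3 : T j₀ ⊂ T j := ⟨h2, fun h => hx0 (h hx)⟩
    exact absurd (hmax j hj) (not_le.2 (card_lt_card h3))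
  -- the shorter ones have no gaps below `b`
  have hint : ∀ j ∈ J, T j ≠ T j₀ → ∀ y ∈ T j, ∀ c, b < c → c < y → c ∈ T j := by
    intro j hj hT y hy c hbc hcy
    have hjj : j ≠ j₀ := fun h => hT (by rw [h])
    obtain ⟨x, hx0, hx⟩ := not_subset.1 fun h => hT (subset_antisymm (hsub j hj) h)
    by_contra hc
    by_cases hc0 : c ∈ T j₀
    · exact lt_asymm hcy (hA j₀ hj₀ j hj hjj.symm c hc0 hc y hy)
    · exact hC j₀ hj₀ j hj hjj.symm c y x hbc hc0 hc hcy (hsub j hj hy) hy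
        (hA j₀ hj₀ j hj hjj.symm x hx0 hx y hy) hx0
  have hfill : ∀ h : ℕ, ∀ j, (∀ y ∈ T j, ∀ c, b < c → c < y → c ∈ T j) →
      ∀ x ∈ seg n (b + 1) h \ T j, ∀ y ∈ T j, y < x := by
    intro h j hj x hx y hy
    rw [mem_sdiff, mem_seg] at hx
    by_contra! hxy
    rcases hxy.lt_or_eq with h1 | h1
    · exact hx.2 (hj y hy x (Fin.lt_def.2 (by omega)) h1)
    · exact hx.2 (h1 ▸ hy)
  by_cases hcase : ∀ j ∈ J, j ≠ j₀ → ∀ y ∈ T j, ∀ c, b < c → c < y → c ∈ T j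
  · -- `h` is the height at which all the columns but `T j₀` have ended
    let h : ℕ := ((J.erase j₀).sup fun j => (T j).sup fun i => (i : ℕ) + 1) ⊔ (b + 1)
    have hlt : ∀ j ∈ J, j ≠ j₀ → ∀ y ∈ T j, (y : ℕ) < h := by
      intro j hj hjj y hy
      have h1 : (y : ℕ) + 1 ≤ (T j).sup fun i => (i : ℕ) + 1 :=
        le_sup (f := fun i : Fin n => (i : ℕ) + 1) hy
      have h2 := le_sup (f := fun j => (T j).sup fun i => (i : ℕ) + 1) (mem_erase.2 ⟨hjj, hj⟩)
      exact lt_of_lt_of_le (Nat.lt_succ_self _) ((h1.trans h2).trans le_sup_left)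
    refine prod_minorY_eq_of_seg J (h := h) (lt_of_lt_of_le (Nat.lt_succ_self _) le_sup_right) hTb
      (fun j hj => ?_) hET hE hET' hE' hw (Or.inl ⟨j₀, hj₀, fun j hj hjj => ?_⟩)
    · by_cases hjj : j = j₀
      · subst hjj
        intro x hx
        rw [mem_sdiff, mem_seg] at hx
        obtain ⟨⟨hbx, hxh⟩, hxT⟩ := hx
        exfalso
        have h1 : (x : ℕ) < (J.erase j).sup fun j => (T j).sup fun i => (i : ℕ) + 1 := by
          rcases lt_sup_iff.1 hxh with h | h
          · exact h
          · omega
        obtain ⟨k, hk, h2⟩ := Finset.lt_sup_iff.1 h1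
        obtain ⟨y, hy, h3⟩ := Finset.lt_sup_iff.1 h2
        rw [mem_erase] at hk
        refine hxT (hsub k hk.2 ?_)
        rcases (Nat.lt_succ_iff.1 h3).lt_or_eq with h4 | h4
        · exact hcase k hk.2 hk.1 y hy x (Fin.lt_def.2 (by omega)) (Fin.lt_def.2 h4)
        · rwa [Fin.ext h4]
      · exact hfill h j (hcase j hj hjj)
    · rw [eq_empty_iff_forall_notMem]
      intro y hy
      rw [mem_hi] at hy
      have := hlt j hj hjj y hy.1
      omega
  · -- two equal columns with a gap `c` below `b`, hence with a single box `y` below it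
    push Not at hcase
    obtain ⟨j₁, hj₁, hjj, y, hy, c', hbc', hcy', hc'⟩ := hcase
    have heq : T j₁ = T j₀ := by
      by_contra h
      exact hc' (hint j₁ hj₁ h y hy c' hbc' hcy')
    rw [heq] at hy hc'
    have hG : (univ.filter fun c => b < c ∧ c ∉ T j₀).Nonempty := ⟨c', by simp [hbc', hc']⟩
    obtain ⟨c, hcG, hcmin⟩ := exists_min_image _ id hG
    simp only [mem_filter, mem_univ, true_and, id] at hcG hcmin
    obtain ⟨hbc, hc⟩ := hcG
    have hcy : c < y := lt_of_le_of_lt (hcmin c' ⟨hbc', hc'⟩) hcy'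
    have hgap := hC j₀ hj₀ j₁ hj₁ hjj.symm c
    rw [heq] at hgap
    have hy_unique : ∀ x ∈ T j₀, c < x → x = y := by
      intro x hx hcx
      rcases lt_trichotomy x y with h | h | h
      · exact absurd hy (hgap x y hbc hc hc hcx hx hx h)
      · exact h
      · exact absurd hx (hgap y x hbc hc hc hcy hy hy h)
    refine prod_minorY_eq_of_seg J (h := c) hbc hTb (fun j hj => ?_) hET hE hET' hE' hw
      (Or.inr ⟨y, fun j hj => ?_⟩)
    · by_cases hj0 : T j = T j₀
      · intro x hx
        rw [mem_sdiff, mem_seg] at hx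
        exfalso
        rw [hj0] at hx
        exact absurd (hcmin x ⟨Fin.lt_def.2 (by omega), hx.2⟩) (not_le.2 (Fin.lt_def.2 hx.1.2))
      · exact hfill c j (hint j hj hj0)
    · have hcne : ∀ x ∈ T j₀, (c : ℕ) ≤ x → c < x := fun x hx hcx =>
        lt_of_le_of_ne (Fin.le_def.2 hcx) fun h => hc (h ▸ hx)
      by_cases hj0 : T j = T j₀
      · right
        rw [hj0]
        ext x
        rw [mem_hi, mem_singleton]
        constructor
        · exact fun hx => hy_unique x hx.1 (hcne x hx.1 hx.2)
        · rintro rfl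
          exact ⟨hy, Fin.le_def.1 hcy.le⟩
      · left
        rw [eq_empty_iff_forall_notMem]
        intro x hx
        rw [mem_hi] at hx
        exact hc (hsub j hj (hint j hj hj0 x hx.1 c hbc
          (hcne x (hsub j hj hx.1) hx.2)))

end Chain

/-! ### Cutting a diagram along a horizontal line -/

section Cut

variable {n : ℕ} {ι : Type*}

lemma card_lo_lo (k b : ℕ) (S : Finset (Fin n)) : #(lo k (lo b S)) = #(lo (min k b) S) := by
  congr 1
  ext i
  simp only [mem_lo, lt_min_iff]
  tauto

lemma galeLE_singleton {r s : Fin n} (h : r ≤ s) : GaleLE {r} {s} := by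
  refine galeLE_iff.2 ⟨by simp, fun k => ?_⟩
  rw [lo, lo, filter_singleton, filter_singleton]
  rw [Fin.le_def] at h
  split_ifs <;> first | (exfalso; omega) | simp

/-- The column `C` with its box below the line at height `b`, if any, pushed down to row `s`. -/
def pushDown (b : ℕ) (s : Fin n) (C : Finset (Fin n)) : Finset (Fin n) :=
  if hi b C = ∅ then C else lo b C ∪ {s}

/-- The part of the column `C` below the line at height `b`, completed to a single box in row `s`
if it is empty. -/
def crossing (b : ℕ) (s : Fin n) (C : Finset (Fin n)) : Finset (Fin n) :=
  if hi b C = ∅ then {s} else hi b C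

section LeftColumn

variable {b s : Fin n} {C S : Finset (Fin n)}

lemma card_hi_le_one (hCS : GaleLE C S) (hS : hi b S ⊆ {s}) : #(hi b C) ≤ 1 :=
  (hCS.card_hi_le b).trans (card_le_card hS)

lemma le_of_galeLE (hbs : b ≤ s) (hCS : GaleLE C S) (hS : hi b S ⊆ {s}) : ∀ x ∈ C, x ≤ s := by
  intro x hx
  refine Fin.le_def.2 (Nat.lt_succ_iff.1 (hCS.lt_of_forall_lt (k := (s : ℕ) + 1) ?_ x hx))
  intro y hy
  rw [Fin.le_def] at hbs
  rcases lt_or_ge (y : ℕ) b with h | h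
  · omega
  · have : y = s := mem_singleton.1 (hS (mem_hi.2 ⟨hy, h⟩))
    rw [this]
    exact Nat.lt_succ_self _

lemma hi_eq_of_nonempty (hCS : GaleLE C S) (hS : hi b S ⊆ {s}) (h : hi b C ≠ ∅) :
    hi b S = {s} ∧ #(hi b C) = 1 ∧ #(lo b C) = #(lo b S) := by
  have h1 := card_pos.2 (nonempty_iff_ne_empty.2 h)
  have h2 := hCS.card_hi_le b
  have h3 := card_le_card hS
  rw [card_singleton] at h3
  have h4 := card_lo_add_card_hi b C
  have h5 := card_lo_add_card_hi b S
  have h6 := hCS.card_eq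
  exact ⟨eq_of_subset_of_card_le hS (by rw [card_singleton]; omega), by omega, by omega⟩

lemma crossing_spec (hbs : b ≤ s) (hCS : GaleLE C S) (hS : hi b S ⊆ {s}) :
    GaleLE (crossing b s C) {s} ∧ ∀ x ∈ crossing b s C, b ≤ x := by
  rw [crossing]
  split_ifs with h
  · exact ⟨galeLE_refl _, by simpa using hbs⟩
  · obtain ⟨r, hr⟩ := card_eq_one.1 (hi_eq_of_nonempty hCS hS h).2.1
    have hrC : r ∈ hi b C := by rw [hr]; exact mem_singleton_self r
    rw [hr]
    refine ⟨galeLE_singleton (le_of_galeLE hbs hCS hS r (mem_hi.1 hrC).1), fun x hx => ?_⟩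
    rw [mem_singleton.1 hx]
    exact Fin.le_def.2 (mem_hi.1 hrC).2

lemma galeLE_pushDown (hbs : b ≤ s) (hCS : GaleLE C S) (hS : hi b S ⊆ {s}) :
    GaleLE (pushDown b s C) S := by
  rw [pushDown]
  split_ifs with h
  · exact hCS
  · obtain ⟨h1, h2, h3⟩ := hi_eq_of_nonempty hCS hS h
    have hdisj : ∀ F : Finset (Fin n), Disjoint (lo b F) {s} := fun F => by
      rw [disjoint_singleton_right, mem_lo, not_and, not_lt]
      exact fun _ => Fin.le_def.1 hbs
    have hS' : S = lo b S ∪ {s} := by rw [← h1, lo_union_hi]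
    refine galeLE_iff.2 ⟨?_, fun k => ?_⟩
    · rw [card_union_of_disjoint (hdisj C), h3, ← card_union_of_disjoint (hdisj S), ← hS']
    · rw [hS', card_lo_union_of_disjoint (hdisj S), card_lo_union_of_disjoint (hdisj C),
        card_lo_lo, card_lo_lo]
      have := hCS.card_lo_le (min k b)
      omega

/-- The minor of a column that has at most the box `s` below the line factors along the line, up
to the factor `y_{ss}`. -/
lemma minorY_mul_eq_pushDown (hbs : b ≤ s) (hCS : GaleLE C S) (hS : hi b S ⊆ {s}) :
    minorY C S * minorY {s} {s} = minorY (pushDown b s C) S * minorY (crossing b s C) {s} := by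
  rw [pushDown, crossing]
  split_ifs with h
  · rfl
  · obtain ⟨h1, h2, h3⟩ := hi_eq_of_nonempty hCS hS h
    have hlo : lo b (lo b C ∪ {s}) = lo b C := by
      ext x
      simp only [mem_lo, mem_union, mem_singleton]
      rw [Fin.le_def] at hbs
      constructor
      · rintro ⟨hx | rfl, h'⟩
        · exact hx
        · omega
      · exact fun hx => ⟨Or.inl hx, hx.2⟩
    have hhi : hi b (lo b C ∪ {s}) = {s} := by
      ext x
      simp only [mem_lo, mem_hi, mem_union, mem_singleton]
      rw [Fin.le_def] at hbs
      constructor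
      · rintro ⟨hx | hx, h'⟩
        · omega
        · exact hx
      · rintro rfl
        exact ⟨Or.inr rfl, hbs⟩
    rw [minorY_split b h3, minorY_split (R := lo b C ∪ {s}) b (by rw [hlo, h3]), hlo, hhi, h1]
    ring

end LeftColumn

lemma rowCount_filter_add (J : Finset ι) (p : ι → Prop) [DecidablePred p]
    (A : ι → Finset (Fin n)) (i : Fin n) :
    rowCount J A i = rowCount (J.filter p) A i + rowCount (J.filter fun j => ¬ p j) A i := by
  simp only [rowCount, filter_filter]
  rw [← card_filter_add_card_filter_not (s := J.filter fun j => i ∈ A j) p]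
  simp only [filter_filter, and_comm]

lemma rowCount_congr {J : Finset ι} {A B : ι → Finset (Fin n)} {i : Fin n}
    (h : ∀ j ∈ J, (i ∈ A j ↔ i ∈ B j)) : rowCount J A i = rowCount J B i :=
  congrArg card (filter_congr h)

/-- Cutting a diagram along the line at height `b`, when the columns with `p` have at most the box
`s` below the line and the others are full above it: the part above the line and the part below it
(in which the columns with `p` are replaced by the single box `s`) can be treated separately. The
weight determines the number of columns with `p` that have a box below the line. -/
lemma prod_minorY_eq_of_cut (J : Finset ι) (p : ι → Prop) [DecidablePred p] {b s : Fin n}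
    (hbs : b ≤ s) {D C C' : ι → Finset (Fin n)}
    (hp : ∀ j ∈ J, p j → hi b (D j) ⊆ {s})
    (hnp : ∀ j ∈ J, ¬ p j → ∀ i : Fin n, (i : ℕ) < b → i ∈ D j)
    (hCD : ∀ j ∈ J, GaleLE (C j) (D j)) (hCD' : ∀ j ∈ J, GaleLE (C' j) (D j))
    (hw : rowCount J C = rowCount J C')
    (habove : ∀ F F' : ι → Finset (Fin n), (∀ j ∈ J.filter p, GaleLE (F j) (D j)) →
      (∀ j ∈ J.filter p, GaleLE (F' j) (D j)) →
      rowCount (J.filter p) F = rowCount (J.filter p) F' →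
      ∏ j ∈ J with p j, minorY (F j) (D j) = ∏ j ∈ J with p j, minorY (F' j) (D j))
    (hbelow : ∀ F F' : ι → Finset (Fin n),
      (∀ j ∈ J, GaleLE (F j) (if p j then {s} else hi b (D j))) → (∀ j ∈ J, ∀ x ∈ F j, b ≤ x) →
      (∀ j ∈ J, GaleLE (F' j) (if p j then {s} else hi b (D j))) → (∀ j ∈ J, ∀ x ∈ F' j, b ≤ x) →
      rowCount J F = rowCount J F' →
      ∏ j ∈ J, minorY (F j) (if p j then {s} else hi b (D j)) =
        ∏ j ∈ J, minorY (F' j) (if p j then {s} else hi b (D j))) :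
    ∏ j ∈ J, minorY (C j) (D j) = ∏ j ∈ J, minorY (C' j) (D j) := by
  -- the parts of a diagram below the line
  let low (F : ι → Finset (Fin n)) : ι → Finset (Fin n) := fun j =>
    if p j then crossing b s (F j) else hi b (F j)
  have hfull : ∀ F : ι → Finset (Fin n), (∀ j ∈ J, GaleLE (F j) (D j)) →
      ∀ j ∈ J, ¬ p j → lo b (F j) = lo b univ := fun F hF j hj hpj => by
    ext i
    simp only [mem_lo, mem_univ, true_and, and_iff_right_iff_imp]
    exact fun hi => (hF j hj).mem_of_forall_lt_mem (hnp j hj hpj) i hi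
  have hlow : ∀ F : ι → Finset (Fin n), (∀ j ∈ J, GaleLE (F j) (D j)) →
      (∀ j ∈ J, GaleLE (low F j) (if p j then {s} else hi b (D j))) ∧
        ∀ j ∈ J, ∀ x ∈ low F j, b ≤ x := by
    intro F hF
    refine ⟨fun j hj => ?_, fun j hj => ?_⟩ <;> by_cases hpj : p j <;>
      simp only [low, hpj, if_true, if_false]
    · exact (crossing_spec hbs (hF j hj) (hp j hj hpj)).1
    · have h1 := hfull F hF j hj hpj
      have h2 := hfull D (fun j _ => galeLE_refl _) j hj hpj
      have h3 := card_lo_add_card_hi b (F j)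
      have h4 := card_lo_add_card_hi b (D j)
      have h5 := (hF j hj).card_eq
      rw [h1] at h3
      rw [h2] at h4
      refine galeLE_iff.2 ⟨by omega, fun k => ?_⟩
      have key : ∀ A : Finset (Fin n), #(lo k A) = #(lo k (lo b A)) + #(lo k (hi b A)) := by
        intro A
        rw [← card_lo_union_of_disjoint, lo_union_hi]
        rw [disjoint_left]
        intro x hx hx'
        exact absurd (mem_lo.1 hx).2 (not_lt.2 (mem_hi.1 hx').2)
      have h6 := (hF j hj).card_lo_le k
      rw [key, key (F j), h1, h2] at h6
      omega
    · exact (crossing_spec hbs (hF j hj) (hp j hj hpj)).2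
    · exact fun x hx => Fin.le_def.2 (mem_hi.1 hx).2
  have hprod : ∀ F : ι → Finset (Fin n), (∀ j ∈ J, GaleLE (F j) (D j)) →
      (∏ j ∈ J, minorY (F j) (D j)) * ∏ j ∈ J with p j, minorY {s} {s} =
        (∏ j ∈ J with p j, minorY (pushDown b s (F j)) (D j)) *
          (∏ j ∈ J with ¬ p j, minorY (lo b (D j)) (lo b (D j))) *
          ∏ j ∈ J, minorY (low F j) (if p j then {s} else hi b (D j)) := by
    intro F hF
    rw [← prod_filter_mul_prod_filter_not J p fun j => minorY (F j) (D j),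
      ← prod_filter_mul_prod_filter_not J p fun j =>
        minorY (low F j) (if p j then {s} else hi b (D j))]
    have h1 : ∏ j ∈ J with p j, minorY (low F j) (if p j then {s} else hi b (D j)) =
        ∏ j ∈ J with p j, minorY (crossing b s (F j)) {s} :=
      prod_congr rfl fun j hj => by
        simp only [low, (mem_filter.1 hj).2, if_true]
    have h2 : ∏ j ∈ J with ¬ p j, minorY (low F j) (if p j then {s} else hi b (D j)) =
        ∏ j ∈ J with ¬ p j, minorY (hi b (F j)) (hi b (D j)) :=
      prod_congr rfl fun j hj => by
        simp only [low, (mem_filter.1 hj).2, if_false]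
    have h3 : ∏ j ∈ J with ¬ p j, minorY (F j) (D j) =
        (∏ j ∈ J with ¬ p j, minorY (lo b (D j)) (lo b (D j))) *
          ∏ j ∈ J with ¬ p j, minorY (hi b (F j)) (hi b (D j)) := by
      rw [← prod_mul_distrib]
      refine prod_congr rfl fun j hj => ?_
      rw [mem_filter] at hj
      have h4 : lo b (F j) = lo b (D j) := by
        rw [hfull F hF j hj.1 hj.2, hfull D (fun j _ => galeLE_refl _) j hj.1 hj.2]
      rw [minorY_split b (by rw [h4]), h4]
    have h4 : (∏ j ∈ J with p j, minorY (F j) (D j)) * ∏ j ∈ J with p j, minorY {s} {s} =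
        (∏ j ∈ J with p j, minorY (pushDown b s (F j)) (D j)) *
          ∏ j ∈ J with p j, minorY (crossing b s (F j)) {s} := by
      rw [← prod_mul_distrib, ← prod_mul_distrib]
      refine prod_congr rfl fun j hj => ?_
      rw [mem_filter] at hj
      exact minorY_mul_eq_pushDown hbs (hF j hj.1) (hp j hj.1 hj.2)
    rw [h1, h2, h3, mul_right_comm, h4]
    ring
  -- above the line, the columns without `p` are full
  have hwlo : rowCount (J.filter p) (fun j => lo b (C j)) =
      rowCount (J.filter p) (fun j => lo b (C' j)) := by
    funext i
    by_cases hi : (i : ℕ) < b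
    · have h1 := congrFun hw i
      rw [rowCount_filter_add J p, rowCount_filter_add J p C'] at h1
      have key : ∀ F : ι → Finset (Fin n), (∀ j ∈ J, GaleLE (F j) (D j)) →
          rowCount (J.filter fun j => ¬ p j) F i =
            rowCount (J.filter fun j => ¬ p j) (fun _ => univ) i := fun F hF =>
        rowCount_congr fun j hj => by
          rw [mem_filter] at hj
          simp [(hF j hj.1).mem_of_forall_lt_mem (hnp j hj.1 hj.2) i hi]
      rw [key C hCD, key C' hCD'] at h1
      have key2 : ∀ F : ι → Finset (Fin n),
          rowCount (J.filter p) (fun j => lo b (F j)) i = rowCount (J.filter p) F i := fun F =>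
        rowCount_congr fun j hj => by simp [hi]
      rw [key2, key2]
      omega
    · have key : ∀ F : ι → Finset (Fin n),
          rowCount (J.filter p) (fun j => lo b (F j)) i = rowCount (J.filter p) (fun _ => ∅) i :=
        fun F => rowCount_congr fun j hj => by simp [hi]
      rw [key, key]
  -- hence the number of columns with `p` that stay above the line is determined
  have hstay : #{j ∈ J.filter p | hi b (C j) = ∅} = #{j ∈ J.filter p | hi b (C' j) = ∅} := by
    have key : ∀ F : ι → Finset (Fin n), (∀ j ∈ J, GaleLE (F j) (D j)) →
        #{j ∈ J.filter p | hi b (F j) = ∅} + ∑ j ∈ J.filter p, #(D j) =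
          #(J.filter p) + ∑ i, rowCount (J.filter p) (fun j => lo b (F j)) i := by
      intro F hF
      rw [← sum_card_eq_sum_rowCount, card_filter, card_eq_sum_ones, ← sum_add_distrib,
        ← sum_add_distrib]
      refine sum_congr rfl fun j hj => ?_
      rw [mem_filter] at hj
      have h1 := card_hi_le_one (hF j hj.1) (hp j hj.1 hj.2)
      have h2 := card_lo_add_card_hi b (F j)
      have h3 := (hF j hj.1).card_eq
      split_ifs with h
      · rw [h, card_empty] at h2
        omega
      · have h4 := card_pos.2 (nonempty_iff_ne_empty.2 h)
        omega
    have h1 := key C hCD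
    have h2 := key C' hCD'
    rw [hwlo] at h1
    omega
  have hcross : #{j ∈ J.filter p | hi b (C j) ≠ ∅} = #{j ∈ J.filter p | hi b (C' j) ≠ ∅} := by
    have h1 := card_filter_add_card_filter_not (s := J.filter p) fun j => hi b (C j) = ∅
    have h2 := card_filter_add_card_filter_not (s := J.filter p) fun j => hi b (C' j) = ∅
    simp only [← ne_eq] at h1 h2
    omega
  rw [Fin.le_def] at hbs
  have hwpush : rowCount (J.filter p) (fun j => pushDown b s (C j)) =
      rowCount (J.filter p) (fun j => pushDown b s (C' j)) := by
    funext i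
    by_cases hi : (i : ℕ) < b
    · have key : ∀ F : ι → Finset (Fin n), rowCount (J.filter p) (fun j => pushDown b s (F j)) i =
          rowCount (J.filter p) (fun j => lo b (F j)) i := fun F =>
        rowCount_congr fun j hj => by
          have : i ≠ s := fun h => by rw [h] at hi; omega
          rw [pushDown]
          split_ifs <;> simp [hi, this]
      rw [key, key, hwlo]
    · by_cases his : i = s
      · have key : ∀ F : ι → Finset (Fin n),
            rowCount (J.filter p) (fun j => pushDown b s (F j)) i =
              #{j ∈ J.filter p | FlaggedWeyl.hi b (F j) ≠ ∅} := fun F => by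
          refine congrArg card (filter_congr fun j hj => ?_)
          change i ∈ pushDown b s (F j) ↔ _
          rw [pushDown]
          split_ifs with h
          · simp only [h, ne_eq, not_true_eq_false, iff_false]
            intro hF
            exact notMem_empty i (h ▸ mem_hi.2 ⟨hF, by omega⟩)
          · simp [h, his]
        rw [key, key, hcross]
      · have key : ∀ F : ι → Finset (Fin n),
            rowCount (J.filter p) (fun j => pushDown b s (F j)) i =
              rowCount (J.filter p) (fun _ => ∅) i := fun F =>
          rowCount_congr fun j hj => by
            rw [pushDown]
            split_ifs with h
            · simp only [notMem_empty, iff_false]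
              intro hF
              exact notMem_empty i (h ▸ mem_hi.2 ⟨hF, by omega⟩)
            · simp [hi, his]
        rw [key, key]
  have hwlow : rowCount J (low C) = rowCount J (low C') := by
    funext i
    by_cases hi : (i : ℕ) < b
    · have key : ∀ F : ι → Finset (Fin n), (∀ j ∈ J, GaleLE (F j) (D j)) →
          rowCount J (low F) i = rowCount J (fun _ => ∅) i := fun F hF =>
        rowCount_congr fun j hj => by
          simp only [notMem_empty, iff_false]
          intro h
          have := Fin.le_def.1 ((hlow F hF).2 j hj i h)
          omega
      rw [key C hCD, key C' hCD']
    · have hhi : ∀ F : ι → Finset (Fin n), ∀ j, (i ∈ FlaggedWeyl.hi b (F j) ↔ i ∈ F j) :=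
        fun F j => by simp [not_lt.1 hi]
      have key : ∀ F : ι → Finset (Fin n), rowCount J (low F) i =
          rowCount J F i + if i = s then #{j ∈ J.filter p | FlaggedWeyl.hi b (F j) = ∅} else 0 := by
        intro F
        rw [rowCount_filter_add J p, rowCount_filter_add J p F]
        have h1 : rowCount (J.filter fun j => ¬ p j) (low F) i =
            rowCount (J.filter fun j => ¬ p j) F i := rowCount_congr fun j hj => by
          simp only [low, (mem_filter.1 hj).2, if_false, hhi]
        have h2 : rowCount (J.filter p) (low F) i = rowCount (J.filter p) F i +
            if i = s then #{j ∈ J.filter p | FlaggedWeyl.hi b (F j) = ∅} else 0 := by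
          rw [rowCount, rowCount, card_filter, card_filter, card_filter]
          have h3 : (if i = s then ∑ j ∈ J.filter p,
              (if FlaggedWeyl.hi b (F j) = ∅ then 1 else 0) else 0) =
              ∑ j ∈ J.filter p, if i = s then
                (if FlaggedWeyl.hi b (F j) = ∅ then 1 else 0) else 0 := by
            split_ifs <;> simp
          rw [h3, ← sum_add_distrib]
          refine sum_congr rfl fun j hj => ?_
          simp only [low, (mem_filter.1 hj).2, if_true, crossing]
          by_cases h : FlaggedWeyl.hi b (F j) = ∅
          · have h4 : i ∉ F j := fun hF => notMem_empty i (h ▸ (hhi F j).2 hF)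
            simp [h, h4]
          · simp [h, not_lt.1 hi]
        omega
      rw [key, key, hw, hstay]
  have hmain := (hprod C hCD).trans ((congrArg₂ (· * ·) (congrArg (· * _)
    (habove _ _ (fun j hj => ?_) (fun j hj => ?_) hwpush))
    (hbelow _ _ (hlow C hCD).1 (hlow C hCD).2 (hlow C' hCD').1 (hlow C' hCD').2 hwlow)).trans
    (hprod C' hCD').symm)
  · exact mul_right_cancel₀ (prod_ne_zero_iff.2 fun j _ => minorY_self_ne_zero {s}) hmain
  · rw [mem_filter] at hj
    exact galeLE_pushDown (Fin.le_def.2 hbs) (hCD j hj.1) (hp j hj.1 hj.2)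
  · rw [mem_filter] at hj
    exact galeLE_pushDown (Fin.le_def.2 hbs) (hCD' j hj.1) (hp j hj.1 hj.2)

end Cut

/-! ### Multiplicity-free diagrams -/

section MultiplicityFree

variable {n : ℕ} {ι : Type*}

/-- The part of `P` from the first gap `b` of `Q` on, when the first gap of `P` is higher: it is
empty, or the box in row `b`, or the first box of `Q` below `b`, which is then the last box of `Q`
unless it lies in the row next to `b`. -/
lemma lower_part_of_first_gap_lt {P Q : Finset (Fin n)} (h₁ : ¬ ContainsConfig P Q)
    (h₂ : ¬ ContainsConfig Q P) {a b q : Fin n} (hab : a < b) (haP : a ∉ P) (haQ : a ∈ Q)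
    (hbQ : b ∉ Q) (hq : q ∈ Q) (hbq : b < q) :
    (b ∈ P → ∀ p ∈ P, p ≤ b) ∧
      ∀ p ∈ P, b < p → (p ∈ Q ∧ ∀ y ∈ Q, b < y → p ≤ y) ∧ (∀ p' ∈ P, b < p' → p' = p) ∧
        ∀ c z, b < c → c < p → z ∈ Q → ¬ p < z := by
  have hfst : b ∈ P → ∀ p ∈ P, p ≤ b := by
    intro hbP p hp
    by_contra! hbp
    have hD : ∀ x, b < x → x ∈ P → x ∉ Q := fun x hbx hxP hxQ =>
      h₁ (.D a b x hab hbx ⟨haP, haQ⟩ ⟨hbP, hbQ⟩ ⟨hxP, hxQ⟩)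
    have hpQ := hD p hbp hp
    have hqP : q ∉ P := fun h => hD q hbq h hq
    rcases lt_trichotomy p q with h | h | h
    · exact h₁ (.E a b p q hab hbp h ⟨haP, haQ⟩ ⟨hbP, hbQ⟩ ⟨hp, hpQ⟩ ⟨hqP, hq⟩)
    · exact hpQ (h ▸ hq)
    · exact h₂ (.F a b q p hab hbq h ⟨haQ, haP⟩ ⟨hbQ, hbP⟩ ⟨hq, hqP⟩ ⟨hpQ, hp⟩)
  refine ⟨hfst, fun p hp hbp => ?_⟩
  have hbP : b ∉ P := fun h => absurd (hfst h p hp) (not_le.2 hbp)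
  -- a row below `b` with a box in only one of the columns is below all boxes of the other one
  have hA₁ : ∀ x, b < x → x ∈ P → x ∉ Q → ∀ y ∈ Q, y ≤ x := fun x hbx hxP hxQ y hy => by
    by_contra! hxy
    exact h₁ (.A b x y hbx hxy ⟨hbP, hbQ⟩ ⟨hxP, hxQ⟩ hy)
  have hA₂ : ∀ x, b < x → x ∈ Q → x ∉ P → ∀ y ∈ P, y ≤ x := fun x hbx hxQ hxP y hy => by
    by_contra! hxy
    exact h₂ (.A b x y hbx hxy ⟨hbQ, hbP⟩ ⟨hxQ, hxP⟩ hy)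
  have hB : ∀ x, b < x → x ∈ P → x ∈ Q → ∀ y ∈ P, y ≤ x := fun x hbx hxP hxQ y hy => by
    by_contra! hxy
    exact h₁ (.B a b x y hab hbx hxy ⟨haP, haQ⟩ ⟨hbP, hbQ⟩ ⟨hxP, hxQ⟩ hy)
  have hle : ∀ x, b < x → x ∈ Q → ∀ y ∈ P, y ≤ x := fun x hbx hxQ y hy => by
    by_cases hxP : x ∈ P
    · exact hB x hbx hxP hxQ y hy
    · exact hA₂ x hbx hxQ hxP y hy
  have hpQ : p ∈ Q := by
    by_contra hpQ
    have h3 := hA₁ p hbp hp hpQ q hq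
    have h4 := hle q hbq hq p hp
    exact hpQ (le_antisymm h3 h4 ▸ hq)
  refine ⟨⟨hpQ, fun y hy hby => hle y hby hy p hp⟩, fun p' hp' hbp' => ?_, ?_⟩
  · refine le_antisymm (hle p hbp hpQ p' hp') ?_
    by_cases h : p' ∈ Q
    · exact hle p' hbp' h p hp
    · exact hA₁ p' hbp' hp' h p hpQ
  · intro c z hbc hcp hz hpz
    have hcQ : c ∉ Q := fun h => absurd (hle c hbc h p hp) (not_le.2 hcp)
    have hcP : c ∉ P := fun h => by
      by_cases h' : c ∈ Q
      · exact hcQ h'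
      · exact absurd (hA₁ c hbc h h' p hpQ) (not_le.2 hcp)
    exact h₂ (.C b c p z hbc hcp hpz ⟨hbQ, hbP⟩ ⟨hcQ, hcP⟩ ⟨hpQ, hp⟩ hz)

/-- Of two columns with gaps above `b`, it cannot happen that one has a box in row `b` but none in
row `s > b`, and the other a box in row `s` but none in row `b`. -/
lemma not_mem_of_first_gaps {P Q : Finset (Fin n)} (h₁ : ¬ ContainsConfig P Q)
    {a c b s : Fin n} (hab : a < b) (hcb : c < b) (haP : a ∉ P) (hcQ : c ∉ Q)
    (hbP : b ∈ P) (hbQ : b ∉ Q) (hsP : s ∉ P) (hbs : b < s) : s ∉ Q := by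
  intro hsQ
  have hA : ∀ i, i < b → i ∉ P → i ∈ Q := fun i hib hiP => by
    by_contra hiQ
    exact h₁ (.A i b s hib hbs ⟨hiP, hiQ⟩ ⟨hbP, hbQ⟩ hsQ)
  have haQ := hA a hab haP
  have hcP : c ∈ P := by
    by_contra h
    exact hcQ (hA c hcb h)
  rcases lt_trichotomy a c with h | h | h
  · exact h₁ (.E a c b s h hcb hbs ⟨haP, haQ⟩ ⟨hcP, hcQ⟩ ⟨hbP, hbQ⟩ ⟨hsP, hsQ⟩)
  · exact hcQ (h ▸ haQ)
  · exact h₁ (.F c a b s h hab hbs ⟨hcP, hcQ⟩ ⟨haP, haQ⟩ ⟨hbP, hbQ⟩ ⟨hsP, hsQ⟩)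

/-- A column without gaps above its last box is minimal in the Gale order. -/
lemma eq_of_galeLE_of_no_gap {C S : Finset (Fin n)} (hCS : GaleLE C S)
    (hS : ∀ i ∉ S, ∀ m ∈ S, m < i) : C = S := by
  symm
  refine eq_of_subset_of_card_le (fun m hm => ?_) hCS.card_eq.le
  refine hCS.mem_of_forall_lt_mem (k := (m : ℕ) + 1) (fun i hi => ?_) m (Nat.lt_succ_self _)
  by_contra h
  have := Fin.lt_def.1 (hS i h m hm)
  omega

/-- In a diagram whose pairs of columns avoid the multiplicitous configurations, the product of
the minors attached to `C ≤ D` depends on the weight of `C` only. -/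
theorem prod_minorY_eq_of_rowCount_eq {D : ι → Finset (Fin n)}
    (hD : ∀ j k, j ≠ k → ¬ ContainsConfig (D j) (D k)) (J : Finset ι) :
    ∀ C C' : ι → Finset (Fin n), (∀ j ∈ J, GaleLE (C j) (D j)) → (∀ j ∈ J, GaleLE (C' j) (D j)) →
      rowCount J C = rowCount J C' →
      ∏ j ∈ J, minorY (C j) (D j) = ∏ j ∈ J, minorY (C' j) (D j) := by
  classical
  induction J using Finset.strongInduction with
  | H J ih =>
  intro C C' hCD hCD' hw
  by_cases htriv : ∃ j ∈ J, ∀ i ∉ D j, ∀ m ∈ D j, m < i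
  · obtain ⟨j, hj, hnogap⟩ := htriv
    have h1 := eq_of_galeLE_of_no_gap (hCD j hj) hnogap
    have h2 := eq_of_galeLE_of_no_gap (hCD' j hj) hnogap
    rw [← mul_prod_erase J _ hj, ← mul_prod_erase J (fun j => minorY (C' j) (D j)) hj, h1, h2,
      ih (J.erase j) (erase_ssubset hj) C C' (fun k hk => hCD k (mem_of_mem_erase hk))
        (fun k hk => hCD' k (mem_of_mem_erase hk)) (funext fun i => ?_)]
    have h3 := congrFun hw i
    simp only [rowCount, card_filter] at h3 ⊢
    rw [← add_sum_erase J _ hj, ← add_sum_erase J (fun j => if i ∈ C' j then 1 else 0) hj,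
      h1, h2] at h3
    exact Nat.add_left_cancel h3
  rcases J.eq_empty_or_nonempty with rfl | hne
  · simp
  have hgap : ∀ j ∈ J, ∃ g, g ∉ D j ∧ (∀ i < g, i ∈ D j) ∧ ∃ m ∈ D j, g < m := by
    intro j hj
    push Not at htriv
    obtain ⟨i, hi, m, hm, him⟩ := htriv j hj
    obtain ⟨g, hg, hmin⟩ := exists_min_image (D j)ᶜ id ⟨i, mem_compl.2 hi⟩
    simp only [mem_compl, id] at hg hmin
    refine ⟨g, hg, fun i' hi' => ?_, m, hm, ?_⟩
    · by_contra h
      exact absurd (hmin i' h) (not_le.2 hi')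
    · refine lt_of_le_of_ne ((hmin i hi).trans him) fun h => hg (h ▸ hm)
  have : Nonempty (Fin n) := ⟨(hgap _ hne.choose_spec).choose⟩
  choose! g hg hgfull q hq hgq using hgap
  -- the cut is made at the lowest first gap
  obtain ⟨j₀, hj₀, hmax⟩ := exists_max_image J g hne
  obtain ⟨b, hb⟩ : ∃ b, g j₀ = b := ⟨_, rfl⟩
  rw [hb] at hmax
  have hright : ∀ j ∈ J, ¬ g j < b → g j = b := fun j hj h => le_antisymm (hmax j hj) (not_lt.1 h)
  have hpair : ∀ j ∈ J, g j < b → ∀ k ∈ J, ¬ g k < b →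
      (b ∈ D j → ∀ p ∈ D j, p ≤ b) ∧
      ∀ p ∈ D j, b < p → (p ∈ D k ∧ ∀ y ∈ D k, b < y → p ≤ y) ∧ (∀ p' ∈ D j, b < p' → p' = p) ∧
        ∀ c z, b < c → c < p → z ∈ D k → ¬ p < z := by
    intro j hj hjb k hk hkb
    have hjk : j ≠ k := fun h => hkb (h ▸ hjb)
    have hgk := hright k hk hkb
    refine lower_part_of_first_gap_lt (hD j k hjk) (hD k j hjk.symm) hjb (hg j hj) ?_ ?_
      (hq k hk) ?_
    · exact hgfull k hk _ (hgk ▸ hjb)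
    · exact hgk ▸ hg k hk
    · exact hgk ▸ hgq k hk
  have hj₀b : ¬ g j₀ < b := by rw [hb]; exact lt_irrefl b
  -- the columns with a higher first gap have at most one box from row `b` on, in a common row `s`
  obtain ⟨s, hbs, hleft, hs⟩ : ∃ s, b ≤ s ∧ (∀ j ∈ J, g j < b → hi b (D j) ⊆ {s}) ∧
      (s = b ∨ b < s ∧ ∀ k ∈ J, ¬ g k < b → s ∈ D k ∧ (∀ y ∈ D k, b < y → s ≤ y) ∧
        ∀ c z, b < c → c < s → z ∈ D k → ¬ s < z) := by
    by_cases hcase : ∀ j ∈ J, g j < b → ∀ p ∈ D j, p ≤ b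
    · refine ⟨b, le_rfl, fun j hj hjb x hx => ?_, Or.inl rfl⟩
      rw [mem_hi] at hx
      exact mem_singleton.2 (le_antisymm (hcase j hj hjb x hx.1) (Fin.le_def.2 hx.2))
    · push Not at hcase
      obtain ⟨j₁, hj₁, hj₁b, s, hs, hbs⟩ := hcase
      have hbj₁ : b ∉ D j₁ := fun h =>
        absurd ((hpair j₁ hj₁ hj₁b j₀ hj₀ hj₀b).1 h s hs) (not_le.2 hbs)
      refine ⟨s, hbs.le, fun j hj hjb x hx => ?_, Or.inr ⟨hbs, fun k hk hkb => ?_⟩⟩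
      · rw [mem_hi] at hx
        rw [mem_singleton]
        have hp := hpair j hj hjb j₀ hj₀ hj₀b
        have hs' := (hpair j₁ hj₁ hj₁b j₀ hj₀ hj₀b).2 s hs hbs
        rcases (Fin.le_def.2 hx.2).lt_or_eq with h | h
        · have hx' := hp.2 x hx.1 h
          exact le_antisymm (hx'.1.2 s hs'.1.1 hbs) (hs'.1.2 x hx'.1.1 h)
        · exfalso
          have hbj : b ∈ D j := h ▸ hx.1
          have hjj : j ≠ j₁ := fun h => hbj₁ (h ▸ hbj)
          exact not_mem_of_first_gaps (hD j j₁ hjj) hjb hj₁b (hg j hj) (hg j₁ hj₁) hbj hbj₁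
            (fun h' => absurd (hp.1 hbj s h') (not_le.2 hbs)) hbs hs
      · have := (hpair j₁ hj₁ hj₁b k hk hkb).2 s hs hbs
        exact ⟨this.1.1, this.1.2, this.2.2⟩
  refine prod_minorY_eq_of_cut J (fun j => g j < b) hbs hleft
    (fun j hj hjb i hi => hgfull j hj i (by rw [hright j hj hjb]; exact Fin.lt_def.2 hi))
    hCD hCD' hw ?_ ?_
  · refine ih _ (filter_ssubset.2 ⟨j₀, hj₀, hj₀b⟩)
  -- the columns with first gap `b`
  have hbnot : ∀ j ∈ J, ¬ g j < b → b ∉ D j := fun j hj hjb => hright j hj hjb ▸ hg j hj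
  have hTb : ∀ j ∈ J, ¬ g j < b → ∀ x ∈ hi b (D j), b < x := fun j hj hjb x hx => by
    rw [mem_hi] at hx
    exact lt_of_le_of_ne (Fin.le_def.2 hx.2) fun h => hbnot j hj hjb (h ▸ hx.1)
  have hnot : ∀ j, ∀ x, b < x → x ∉ hi b (D j) → x ∉ D j := fun j x hbx hx h =>
    hx (mem_hi.2 ⟨h, Fin.le_def.1 hbx.le⟩)
  have hA : ∀ j ∈ J, ¬ g j < b → ∀ k ∈ J, ¬ g k < b → j ≠ k → ∀ x ∈ hi b (D j), x ∉ hi b (D k) →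
      ∀ y ∈ hi b (D k), y < x := by
    intro j hj hjb k hk hkb hjk x hx hxk y hy
    by_contra! hxy
    have hbx := hTb j hj hjb x hx
    have hxy' : x < y := lt_of_le_of_ne hxy fun h => hxk (h ▸ hy)
    exact hD j k hjk (.A b x y hbx hxy' ⟨hbnot j hj hjb, hbnot k hk hkb⟩
      ⟨(mem_hi.1 hx).1, hnot k x hbx hxk⟩ (mem_hi.1 hy).1)
  have hC : ∀ j ∈ J, ¬ g j < b → ∀ k ∈ J, ¬ g k < b → j ≠ k → ∀ c x y, b < c → c ∉ hi b (D j) →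
      c ∉ hi b (D k) → c < x → x ∈ hi b (D j) → x ∈ hi b (D k) → x < y → y ∉ hi b (D j) := by
    intro j hj hjb k hk hkb hjk c x y hbc hcj hck hcx hxj hxk hxy hyj
    exact hD j k hjk (.C b c x y hbc hcx hxy ⟨hbnot j hj hjb, hbnot k hk hkb⟩
      ⟨hnot j c hbc hcj, hnot k c hbc hck⟩ ⟨(mem_hi.1 hxj).1, (mem_hi.1 hxk).1⟩ (mem_hi.1 hyj).1)
  intro F F' hF hFb hF' hFb' hFw
  rcases hs with rfl | ⟨hbs', hs⟩
  · -- the boxes in row `b` of the columns with a higher first gap are fixed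
    have hfix : ∀ F : ι → Finset (Fin n),
        (∀ j ∈ J, GaleLE (F j) (if g j < s then {s} else hi s (D j))) →
        (∀ j ∈ J, ∀ x ∈ F j, s ≤ x) → ∀ j ∈ J, g j < s → F j = {s} := by
      intro F hF hFb j hj hjs
      have h1 := hF j hj
      rw [if_pos hjs] at h1
      obtain ⟨r, hr⟩ := card_eq_one.1 (h1.card_eq.trans (card_singleton s))
      rw [hr] at h1 ⊢
      have h2 := hFb j hj r (by rw [hr]; exact mem_singleton_self r)
      have h3 := h1.lt_of_forall_lt (k := (s : ℕ) + 1)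
        (fun y hy => by rw [mem_singleton.1 hy]; exact Nat.lt_succ_self _) r (mem_singleton_self r)
      rw [le_antisymm (Fin.le_def.2 (Nat.lt_succ_iff.1 h3)) h2]
    rw [← prod_filter_mul_prod_filter_not J (fun j => g j < s),
      ← prod_filter_mul_prod_filter_not J (fun j => g j < s)
        (f := fun j => minorY (F' j) (if g j < s then {s} else hi s (D j)))]
    congr 1
    · refine prod_congr rfl fun j hj => ?_
      rw [mem_filter] at hj
      rw [hfix F hF hFb j hj.1 hj.2, hfix F' hF' hFb' j hj.1 hj.2]
    · have hT : ∀ j ∈ J.filter fun j => ¬ g j < s,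
          (if g j < s then {s} else hi s (D j)) = hi s (D j) := fun j hj =>
        if_neg (mem_filter.1 hj).2
      rw [prod_congr rfl fun j hj => by rw [hT j hj],
        prod_congr (f := fun j => minorY (F' j) (if g j < s then {s} else hi s (D j))) rfl
          fun j hj => by rw [hT j hj]]
      have hJ : ∀ j ∈ J.filter fun j => ¬ g j < s, j ∈ J ∧ ¬ g j < s := fun j hj => mem_filter.1 hj
      refine prod_minorY_eq_of_chain _ (b := s) (fun j hj => hTb j (hJ j hj).1 (hJ j hj).2)
        (fun j hj k hk => hA j (hJ j hj).1 (hJ j hj).2 k (hJ k hk).1 (hJ k hk).2)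
        (fun j hj k hk => hC j (hJ j hj).1 (hJ j hj).2 k (hJ k hk).1 (hJ k hk).2)
        (fun j hj => by rw [← hT j hj]; exact hF j (hJ j hj).1) (fun j hj => hFb j (hJ j hj).1)
        (fun j hj => by rw [← hT j hj]; exact hF' j (hJ j hj).1) (fun j hj => hFb' j (hJ j hj).1)
        (funext fun i => ?_)
      have h1 := congrFun hFw i
      rw [rowCount_filter_add J (fun j => g j < s),
        rowCount_filter_add J (fun j => g j < s) F',
        rowCount_congr (J := J.filter fun j => g j < s) (A := F) (B := F') fun j hj => by
          rw [mem_filter] at hj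
          rw [hfix F hF hFb j hj.1 hj.2, hfix F' hF' hFb' j hj.1 hj.2]] at h1
      exact Nat.add_left_cancel h1
  · -- the single boxes in row `s` extend the chain of the columns with first gap `b`
    have hsk : ∀ k ∈ J, ¬ g k < b → s ∈ hi b (D k) := fun k hk hkb =>
      mem_hi.2 ⟨(hs k hk hkb).1, Fin.le_def.1 hbs⟩
    refine prod_minorY_eq_of_chain J (b := b) (fun j hj x hx => ?_)
      (fun j hj k hk hjk x hx hxk y hy => ?_)
      (fun j hj k hk hjk c x y hbc hcj hck hcx hxj hxk hxy hyj => ?_) hF hFb hF' hFb' hFw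
    · split_ifs at hx with hjb
      · rwa [mem_singleton.1 hx]
      · exact hTb j hj hjb x hx
    · split_ifs at hx hxk hy with hjb hkb hkb
      · exact absurd hx hxk
      · exact absurd (mem_singleton.1 hx ▸ hsk k hk hkb) hxk
      · rw [mem_singleton] at hy hxk
        rw [hy]
        exact lt_of_le_of_ne ((hs j hj hjb).2.1 x (mem_hi.1 hx).1 (hTb j hj hjb x hx))
          (Ne.symm hxk)
      · exact hA j hj hjb k hk hkb hjk x hx hxk y hy
    · split_ifs at hcj hck hxj hxk hyj with hjb hkb hkb
      · exact hxy.ne ((mem_singleton.1 hxj).trans (mem_singleton.1 hyj).symm)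
      · exact hxy.ne ((mem_singleton.1 hxj).trans (mem_singleton.1 hyj).symm)
      · rw [mem_singleton] at hxk
        rw [hxk] at hcx hxy
        exact (hs j hj hjb).2.2 c y hbc hcx (mem_hi.1 hyj).1 hxy
      · exact hC j hj hjb k hk hkb hjk c x y hbc hcj hck hcx hxj hxk hxy hyj

end MultiplicityFree

end

end FlaggedWeyl

theorem mainTheorem2 (n : ℕ) (D : FlaggedWeyl.Diagram n) :
    FlaggedWeyl.IsZeroOne (FlaggedWeyl.dualCharacter D) ↔ FlaggedWeyl.IsMultiplicityFree D := by
  constructor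
  · rintro h ⟨j, k, hjk, hc | hc⟩
    · exact FlaggedWeyl.not_isZeroOne_of_containsConfig hjk.ne hc h
    · exact FlaggedWeyl.not_isZeroOne_of_containsConfig hjk.ne' hc h
  · intro h
    refine FlaggedWeyl.isZeroOne_of_detY_eq fun C C' hC hC' hw =>
      FlaggedWeyl.prod_minorY_eq_of_rowCount_eq (fun j k hjk hc => h ?_) Finset.univ C C'
        (fun j _ => hC j) (fun j _ => hC' j) hw
    rcases hjk.lt_or_gt with hlt | hlt
    · exact ⟨j, k, hlt, Or.inl hc⟩
    · exact ⟨k, j, hlt, Or.inr hc⟩
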